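/- Let $k\ge 2$ be an even integer and let $d,n\ge 1$ be integers and $p\in[0,1]$. Let $\Phi$ be a random $k$-XOR instance on $n$ variables: each of the $n^k$ tuples $S\in[n]^k$ is sampled independently with probability $p$, and each sampled $S=(s_1,\dots,s_k)$ receives an independent uniformly random sign $\eta_S\in\{\pm1\}$, giving the constraint $\prod_{i=1}^k x_{s_i}=\eta_S$. Put $T_S=\eta_S$ if $S$ is sampled and $T_S=0$ otherwise, and let $S^\Phi$ be the $n^{k/2}\times n^{k/2}$ matrix $$S^\Phi_{U,V}=\tfrac12\bigl(T_{(U,V)}+T_{(V,U)}\bigr),\qquad U,V\in[n]^{k/2}.$$ Let $S^{\Phi,d}$ be the $d$-th Kronecker power of $S^\Phi$, indexed by $kd/2$-tuples $I=(U_1,\dots,U_d)$, $J=(V_1,\dots,V_d)$ with $U_s,V_s\in[n]^{k/2}$, so that $S^{\Phi,d}_{I,J}=\prod_{s=1}^d S^\Phi_{U_s,V_s}$, and let $$R^{\Phi,d}_{I,J}=\frac1{|\mathbb S_{kd/2}|^2}\sum_{\pi,\sigma\in\mathbb S_{kd/2}}S^{\Phi,d}_{\pi(I),\sigma(J)},\qquad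 I,J\in[n]^{kd/2},$$ where $\mathbb S_{kd/2}$ is the group of permutations of the $kd/2$ positions and $\pi(i_1,\dots,i_{kd/2})=(i_{\pi(1)},\dots,i_{\pi(kd/2)})$. Let $R^{\Phi,d,\mathrm{trim}}$ be obtained from $R^{\Phi,d}$ by removing all rows and columns indexed by tuples $I$ in which some $i\in[n]$ appears more than $10\log n$ times ($\log$ is the natural logarithm). There is an absolute constant $c>0$ such that, for all such $k,d,n,p$ with $d^{k/2-1}n^{k/2}p>1$, with probability at least $1-n^{-2}$, $$\bigl\|R^{\Phi,d,\mathrm{trim}}\bigr\|^{1/d}\le c\cdot\frac{e^{3k/4}\,10^{5k/2}}{(k/2)^{k/4}}\cdot\frac{n^{k/4}p^{1/2}}{d^{(k-2)/4}}\cdot(\log n)^{5k/2+1},$$ where $\|\cdot\|$ is the spectral norm. -/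

import Mathlib

open MeasureTheory

noncomputable section

namespace KXOR

/-- A `k`-XOR instance on `n` variables. For a `k`-tuple `S`, the value `some η` says that the
constraint `∏ i, x (S i) = η` is present, and `none` says that `S` carries no constraint. -/
abbrev XORInstance (n k : ℕ) : Type := (Fin k → Fin n) → Option ℤˣ

instance instMeasurableSpaceConstraint : MeasurableSpace (Option ℤˣ) := ⊤

/-- The law of the constraint carried by a single tuple: the tuple is sampled with probability
`p`, and a sampled tuple receives a uniformly random sign. -/
def constraintLaw (p : ℝ) : Measure (Option ℤˣ) :=
  ENNReal.ofReal (1 - p) • Measure.dirac none +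
    ENNReal.ofReal (p / 2) • Measure.dirac (some 1) +
    ENNReal.ofReal (p / 2) • Measure.dirac (some (-1))

theorem isProbabilityMeasure_constraintLaw {p : ℝ} (h0 : 0 ≤ p) (h1 : p ≤ 1) :
    IsProbabilityMeasure (constraintLaw p) := by
  constructor
  simp only [constraintLaw, Measure.coe_add, Measure.coe_smul, Pi.add_apply, Pi.smul_apply,
    measure_univ, smul_eq_mul, mul_one]
  rw [← ENNReal.ofReal_add (by linarith) (by linarith),
    ← ENNReal.ofReal_add (by linarith) (by linarith),
    show 1 - p + p / 2 + p / 2 = 1 by ring, ENNReal.ofReal_one]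

/-- The law of a random `k`-XOR instance with probability `p`: the `n ^ k` tuples are treated
independently. -/
def randomXOR (n k : ℕ) (p : ℝ) : Measure (XORInstance n k) :=
  Measure.pi fun _ => constraintLaw p

variable {n k : ℕ}

/-- The constraints tensor: the sign of the constraint on `S`, or `0` if there is none. -/
def constraintsTensor (Φ : XORInstance n k) (S : Fin k → Fin n) : ℝ :=
  match Φ S with
  | none => 0
  | some η => ((η : ℤ) : ℝ)

/-- The `k`-tuple `(U, V)` made of two `k/2`-tuples, for even `k`. -/
def joinHalves (hk : Even k) (U V : Fin (k / 2) → Fin n) : Fin k → Fin n :=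
  fun i => Fin.append U V
    (Fin.cast (by have := Nat.div_two_mul_two_of_even hk; omega : k = k / 2 + k / 2) i)

/-- The natural `n^(k/2) × n^(k/2)` flattening of the constraints tensor. -/
def flattening (hk : Even k) (Φ : XORInstance n k) :
    Matrix (Fin (k / 2) → Fin n) (Fin (k / 2) → Fin n) ℝ :=
  Matrix.of fun U V => constraintsTensor Φ (joinHalves hk U V)

/-- The symmetric matrix representation `S^Φ`. -/
def symRep (hk : Even k) (Φ : XORInstance n k) :
    Matrix (Fin (k / 2) → Fin n) (Fin (k / 2) → Fin n) ℝ :=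
  (1 / 2 : ℝ) • (flattening hk Φ + (flattening hk Φ).transpose)

/-- The `kd/2` positions of an index tuple, arranged in `d` consecutive blocks of length `k/2`;
`(s, t)` is the `t`-th position of the `s`-th block. -/
abbrev Position (k d : ℕ) : Type := Fin d × Fin (k / 2)

/-- Index tuples in `[n]^(kd/2)`. The blocks of `I` are `U_s = fun t => I (s, t)`. -/
abbrev IndexTuple (n k d : ℕ) : Type := Position k d → Fin n

/-- The `d`-th Kronecker power `S^{Φ,d}` of `S^Φ`. -/
def kroneckerPower (hk : Even k) (d : ℕ) (Φ : XORInstance n k) :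
    Matrix (IndexTuple n k d) (IndexTuple n k d) ℝ :=
  Matrix.of fun I J => ∏ s : Fin d, symRep hk Φ (fun t => I (s, t)) (fun t => J (s, t))

/-- The higher-order symmetric matrix `R^{Φ,d}`: the average of `S^{Φ,d}` over all permutations
of the positions of the row index and of the column index. -/
def higherOrderSym (hk : Even k) (d : ℕ) (Φ : XORInstance n k) :
    Matrix (IndexTuple n k d) (IndexTuple n k d) ℝ :=
  Matrix.of fun I J =>
    (1 / (Fintype.card (Equiv.Perm (Position k d)) : ℝ) ^ 2) *
      ∑ π : Equiv.Perm (Position k d), ∑ σ : Equiv.Perm (Position k d),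
        kroneckerPower hk d Φ (I ∘ π) (J ∘ σ)

/-- The histogram of an index tuple: `hist I i` is the number of times `i` appears in `I`. -/
def hist {d : ℕ} (I : IndexTuple n k d) (i : Fin n) : ℕ :=
  (Finset.univ.filter fun q : Position k d => I q = i).card

/-- The index tuples that survive the trimming: no histogram coordinate exceeds `10 log n`. -/
abbrev KeptTuple (n k d : ℕ) : Type :=
  {I : IndexTuple n k d // ∀ i : Fin n, ¬ ((hist I i : ℝ) > 10 * Real.log n)}

/-- `KeptTuple` is finite, as a subtype of a finite type. -/
instance instFintypeKeptTuple (n k d : ℕ) : Fintype (KeptTuple n k d) := Fintype.ofFinite _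

/-- The trimmed matrix: all rows and columns of `R^{Φ,d}` whose index has a histogram coordinate
larger than `10 log n` are removed. -/
def trimmed (hk : Even k) (d : ℕ) (Φ : XORInstance n k) :
    Matrix (KeptTuple n k d) (KeptTuple n k d) ℝ :=
  (higherOrderSym hk d Φ).submatrix Subtype.val Subtype.val

/-- The spectral norm of a real square matrix: the operator norm on Euclidean space. -/
def spectralNorm {ι : Type*} [Fintype ι] [DecidableEq ι] (A : Matrix ι ι ℝ) : ℝ :=
  ‖Matrix.toEuclideanCLM (n := ι) (𝕜 := ℝ) A‖

end KXOR

end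

/-! Write m = k/2, L = 10 log n, and let P project to the tuples in which no value occurs more than
L times. The trimmed matrix is a submatrix of M = P R P, so it suffices to bound E tr((M Mᵀ)^q) for
q of order m log n and apply Markov's inequality (`norm_pow_le_trace`,
`one_sub_le_measureReal_spectralNorm_le`).

The Kronecker power is a product of operators S_t, each acting on one block t < d, and R is this
product between two full symmetrizers. A full capped symmetrizer absorbs the capped symmetrizers of
all subsets of positions, and these commute with whatever acts on disjoint positions. Hence M is
also the product of the factors C_{≤t} S_t C_{≥t}, where C_{≤t} and C_{≥t} are the capped
symmetrizers of the blocks up to t and from t on (`prod_insert_absorbing_eq`, `cappedProduct_eq`).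

Each factor is linear in the constraints, ∑ T_τ F_τ with nonnegative F_τ. All F_τ together have row
sums at most n^m. A single F_τ has tiny row sums: C_{≤t} randomly permutes (t+1)m positions, and
because of the cap a prescribed word lands in block t with probability at most L^m / ((t+1)m)_m, a
falling factorial (`card_permsOn_block_eq_mul_le`). In Mᵀ the leading symmetrizer is C_{≥t}, with
d-t in place of t+1.

A word of constraints has nonzero expectation only if every letter occurs an even number of times,
so for η ≥ 1 its expectation is at most η^length (p/η²)^(number of distinct letters). Reading the
product from left to right, a factor contributes n^m p/η² through a new letter and at most (word
length) · (single row sum) through one of the letters already seen (`integral_prod_mulVec_le`). The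
parameter η balances the two: η² = m^m d^(m-1) n^m p makes the first 1/(m^m d^(m-1)), and the
density hypothesis gives η ≥ 1. The dependence of the second on t is harmless, as ∏ d²/((t+1)(d-t))
= (d^d/d!)² ≤ e^(2d). What remains per factor is η/(m^m d^(m-1)) = √(n^m p)/√(m^m d^(m-1)), up to
the logarithmic and exponential terms of the statement. -/

noncomputable section

namespace KXOR

/-! ### Spectral norm, traces and submatrices. -/

section SpectralNorm

variable {ι κ : Type*} [Fintype ι] [DecidableEq ι] [Fintype κ] [DecidableEq κ]

open scoped Matrix.Norms.L2Operator

theorem spectralNorm_eq_norm (A : Matrix ι ι ℝ) : spectralNorm A = ‖A‖ := rfl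

theorem norm_sq_le_trace (A : Matrix ι ι ℝ) : ‖A‖ ^ 2 ≤ (A.transpose * A).trace := by
  have htr : (A.transpose * A).trace = ∑ i, ∑ j, A i j ^ 2 := by
    rw [Matrix.trace, Finset.sum_comm]
    refine Finset.sum_congr rfl fun j _ => ?_
    simp [Matrix.diag, Matrix.mul_apply, sq]
  have h0 : 0 ≤ (A.transpose * A).trace := by rw [htr]; positivity
  have h : ‖A‖ ≤ √((A.transpose * A).trace) := by
    rw [Matrix.cstar_norm_def]
    refine ContinuousLinearMap.opNorm_le_bound _ (Real.sqrt_nonneg _) fun x => ?_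
    rw [EuclideanSpace.norm_eq x, ← Real.sqrt_mul h0, EuclideanSpace.norm_eq]
    refine Real.sqrt_le_sqrt ?_
    rw [htr, Finset.sum_mul]
    refine Finset.sum_le_sum fun i _ => ?_
    simp only [Real.norm_eq_abs, sq_abs, Matrix.ofLp_toEuclideanCLM, Matrix.mulVec, dotProduct]
    exact Finset.sum_mul_sq_le_sq_mul_sq _ _ _
  calc ‖A‖ ^ 2 ≤ √((A.transpose * A).trace) ^ 2 := by gcongr
    _ = _ := Real.sq_sqrt h0

/-- The C*-identity gives norms of powers of the self-adjoint `A * A.transpose` for exponents that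
are powers of two; one further squaring is paid for by the Frobenius bound. -/
theorem norm_pow_le_trace (A : Matrix ι ι ℝ) (a : ℕ) :
    ‖A‖ ^ (2 * 2 ^ (a + 1)) ≤ ((A * A.transpose) ^ 2 ^ (a + 1)).trace := by
  have hs : IsSelfAdjoint (A * A.transpose) := by
    rw [isSelfAdjoint_iff, Matrix.star_eq_conjTranspose, Matrix.conjTranspose_eq_transpose_of_trivial,
      Matrix.transpose_mul, Matrix.transpose_transpose]
  have h1 : ‖A * A.transpose‖ = ‖A‖ ^ 2 := by
    have := CStarRing.norm_self_mul_star (x := A)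
    rwa [Matrix.star_eq_conjTranspose, Matrix.conjTranspose_eq_transpose_of_trivial, ← sq] at this
  have h2 := norm_sq_le_trace ((A * A.transpose) ^ 2 ^ a)
  have h3 : ((A * A.transpose) ^ 2 ^ a).transpose = (A * A.transpose) ^ 2 ^ a := by
    rw [Matrix.transpose_pow, Matrix.transpose_mul, Matrix.transpose_transpose]
  rw [h3, ← pow_add, ← two_mul, ← pow_succ', hs.norm_pow_two_pow, h1] at h2
  rwa [← pow_mul, ← pow_mul, ← pow_succ] at h2

/-- The submatrix is `V.transpose * A * V` for the isometry `V` that embeds coordinates along `f`.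
-/
theorem norm_submatrix_le (A : Matrix ι ι ℝ) {f : κ → ι} (hf : Function.Injective f) :
    ‖A.submatrix f f‖ ≤ ‖A‖ := by
  let V : Matrix ι κ ℝ := Matrix.of fun i j => if i = f j then 1 else 0
  have hV : V.transpose * V = 1 := by
    ext i j
    simp [V, Matrix.mul_apply, Matrix.one_apply, hf.eq_iff, eq_comm]
  have hVn : ‖V‖ ≤ 1 := by
    have := Matrix.l2_opNorm_conjTranspose_mul_self V
    rw [Matrix.conjTranspose_eq_transpose_of_trivial, hV] at this
    have h1 : ‖(1 : Matrix κ κ ℝ)‖ ≤ 1 := by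
      rw [← Matrix.diagonal_one, Matrix.l2_opNorm_diagonal]
      refine (pi_norm_le_iff_of_nonneg zero_le_one).2 fun i => by simp
    nlinarith [norm_nonneg V]
  have hA : A.submatrix f f = V.transpose * A * V := by
    ext i j
    simp [V, Matrix.mul_apply]
  have hVt : ‖V.transpose‖ ≤ 1 := by
    rwa [← Matrix.conjTranspose_eq_transpose_of_trivial, Matrix.l2_opNorm_conjTranspose]
  rw [hA]
  calc ‖V.transpose * A * V‖ ≤ ‖V.transpose * A‖ * ‖V‖ := Matrix.l2_opNorm_mul _ _
    _ ≤ (‖V.transpose‖ * ‖A‖) * ‖V‖ := by gcongr; exact Matrix.l2_opNorm_mul _ _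
    _ ≤ (1 * ‖A‖) * 1 := by gcongr
    _ = ‖A‖ := by ring

end SpectralNorm

/-! ### Expected products of random combinations of nonnegative matrices. -/

section RandomProducts

variable {Ω K ι : Type*} [Fintype K] [DecidableEq K] [Fintype ι] [DecidableEq ι]

/-- The random matrix `∑ τ, T τ • F τ` with coefficients `T τ`. -/
def randomCombination (T : K → Ω → ℝ) (F : K → Matrix ι ι ℝ) (ω : Ω) : Matrix ι ι ℝ :=
  ∑ τ, T τ ω • F τ

/-- `F` is a family of nonnegative matrices whose row sums are at most `w`, and the row sums of
whose total are at most `D`. -/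
structure RowBounded (F : K → Matrix ι ι ℝ) (D w : ℝ) : Prop where
  nonneg : ∀ τ x y, 0 ≤ F τ x y
  total : ∀ x, ∑ τ, ∑ y, F τ x y ≤ D
  single : ∀ τ x, ∑ y, F τ x y ≤ w

/-- Here `s` is the set of letters already seen. A new letter is discounted by `a` and charged to
the total `D`; a seen letter is not discounted, but there are only `s.card` of them, each of weight
at most `w`. -/
theorem sum_mul_ite_le {r : K → ℝ} {a D w : ℝ} (ha : 0 ≤ a) (hr : ∀ τ, 0 ≤ r τ)
    (hD : ∑ τ, r τ ≤ D) (hw : ∀ τ, r τ ≤ w) (s : Finset K) :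
    ∑ τ, r τ * (if τ ∈ s then 1 else a) ≤ D * a + s.card * w := by
  calc ∑ τ, r τ * (if τ ∈ s then 1 else a)
      ≤ ∑ τ, (r τ * a + if τ ∈ s then w else 0) := by
        refine Finset.sum_le_sum fun τ _ => ?_
        split_ifs
        · nlinarith [hw τ, mul_nonneg (hr τ) ha]
        · simp
    _ = (∑ τ, r τ) * a + s.card * w := by
        rw [Finset.sum_add_distrib, Finset.sum_mul]; simp [Finset.sum_ite_mem]
    _ ≤ _ := by gcongr

/-- The list `l` records the letters chosen in the factors already expanded. Carrying it through the
induction allows peeling off one factor at a time, with no enumeration of coincidence patterns; `R`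
bounds the number of seen letters throughout. -/
theorem integral_prod_mulVec_le [MeasurableSpace Ω] [Finite Ω] [MeasurableSingletonClass Ω]
    {μ : Measure Ω} [IsFiniteMeasure μ] {T : K → Ω → ℝ} {η a D : ℝ} (hη : 0 ≤ η) (ha : 0 ≤ a)
    (hD : 0 ≤ D)
    (hT : ∀ l : List K, ∫ ω, (l.map fun τ => T τ ω).prod ∂μ ≤
      η ^ l.length * a ^ l.toFinset.card)
    (hT0 : ∀ l : List K, 0 ≤ ∫ ω, (l.map fun τ => T τ ω).prod ∂μ) (R : ℕ)
    (L : List ((K → Matrix ι ι ℝ) × ℝ)) (hL : ∀ F ∈ L, RowBounded F.1 D F.2 ∧ 0 ≤ F.2) :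
    ∀ l : List K, l.length + L.length ≤ R → ∀ v : ι → ℝ, (∀ x, 0 ≤ v x) → (∀ x, v x ≤ 1) →
      ∀ x, ∫ ω, (l.map fun τ => T τ ω).prod *
        ((L.map fun F => randomCombination T F.1 ω).prod.mulVec v) x ∂μ ≤
      η ^ (l.length + L.length) * a ^ l.toFinset.card *
        (L.map fun F => D * a + R * F.2).prod := by
  induction L with
  | nil =>
    intro l _ v hv0 hv1 x
    simp only [List.map_nil, List.prod_nil, Matrix.one_mulVec, integral_mul_const,
      List.length_nil, add_zero, mul_one]
    calc _ ≤ (∫ ω, (l.map fun τ => T τ ω).prod ∂μ) * 1 :=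
          mul_le_mul_of_nonneg_left (hv1 x) (hT0 l)
      _ ≤ _ := by rw [mul_one]; exact hT l
  | cons F L ih =>
    intro l hl v hv0 hv1 x
    have hFL := hL F (by simp)
    have ih' := ih fun G hG => hL G (List.mem_cons_of_mem _ hG)
    have hlen : l.length + 1 + L.length ≤ R := by simp at hl; omega
    set C : ℝ := (L.map fun F => D * a + R * F.2).prod with hC
    have hC0 : 0 ≤ C := by
      refine List.prod_nonneg fun y hy => ?_
      obtain ⟨G, hG, rfl⟩ := List.mem_map.1 hy
      have := (hL G (List.mem_cons_of_mem _ hG)).2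
      positivity
    have hexp : ∀ ω, (l.map fun τ => T τ ω).prod *
        (((F :: L).map fun F => randomCombination T F.1 ω).prod.mulVec v) x =
        ∑ τ, ∑ z, F.1 τ x z * (((τ :: l).map fun τ => T τ ω).prod *
          ((L.map fun F => randomCombination T F.1 ω).prod.mulVec v) z) := by
      intro ω
      rw [List.map_cons, List.prod_cons, ← Matrix.mulVec_mulVec]
      generalize ((L.map fun F => randomCombination T F.1 ω).prod.mulVec v) = u
      simp only [Matrix.mulVec, dotProduct, randomCombination, Matrix.sum_apply, Matrix.smul_apply,
        smul_eq_mul, Finset.sum_mul, Finset.mul_sum, List.map_cons, List.prod_cons]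
      rw [Finset.sum_comm]
      refine Finset.sum_congr rfl fun τ _ => Finset.sum_congr rfl fun z _ => by ring
    simp only [hexp]
    rw [integral_finsetSum _ fun _ _ => Integrable.of_finite]
    simp_rw [integral_finsetSum _ fun _ _ => Integrable.of_finite, integral_const_mul]
    calc _ ≤ ∑ τ, ∑ z, F.1 τ x z * (η ^ (l.length + 1 + L.length) *
            (a ^ l.toFinset.card * (if τ ∈ l.toFinset then 1 else a)) * C) := by
          refine Finset.sum_le_sum fun τ _ => Finset.sum_le_sum fun z _ =>
            mul_le_mul_of_nonneg_left ?_ (hFL.1.nonneg τ x z)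
          have := ih' (τ :: l) (by simpa using hlen) v hv0 hv1 z
          have hcard : a ^ (τ :: l).toFinset.card =
              a ^ l.toFinset.card * (if τ ∈ l.toFinset then 1 else a) := by
            rw [List.toFinset_cons]
            split_ifs with h
            · rw [Finset.insert_eq_of_mem h, mul_one]
            · rw [Finset.card_insert_of_notMem h, pow_succ]
          rwa [hcard, List.length_cons] at this
      _ = (η ^ (l.length + 1 + L.length) * a ^ l.toFinset.card * C) *
            ∑ τ, (∑ z, F.1 τ x z) * (if τ ∈ l.toFinset then 1 else a) := by
          simp_rw [Finset.mul_sum, Finset.sum_mul, Finset.mul_sum]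
          refine Finset.sum_congr rfl fun τ _ => Finset.sum_congr rfl fun z _ => by ring
      _ ≤ (η ^ (l.length + 1 + L.length) * a ^ l.toFinset.card * C) * (D * a + R * F.2) := by
          refine mul_le_mul_of_nonneg_left ?_ (by positivity)
          refine (sum_mul_ite_le ha (fun τ => Finset.sum_nonneg fun z _ => hFL.1.nonneg τ x z)
            (hFL.1.total x) (fun τ => hFL.1.single τ x) _).trans ?_
          have h1 : l.toFinset.card ≤ R := (List.toFinset_card_le l).trans (by omega)
          have h2 := hFL.2
          gcongr
      _ = _ := by
          rw [List.map_cons, List.prod_cons, List.length_cons, ← hC]; ring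

theorem integral_trace_prod_le [MeasurableSpace Ω] [Finite Ω] [MeasurableSingletonClass Ω]
    {μ : Measure Ω} [IsFiniteMeasure μ] {T : K → Ω → ℝ} {η a D : ℝ} (hη : 0 ≤ η) (ha : 0 ≤ a)
    (hD : 0 ≤ D)
    (hT : ∀ l : List K, ∫ ω, (l.map fun τ => T τ ω).prod ∂μ ≤
      η ^ l.length * a ^ l.toFinset.card)
    (hT0 : ∀ l : List K, 0 ≤ ∫ ω, (l.map fun τ => T τ ω).prod ∂μ)
    (L : List ((K → Matrix ι ι ℝ) × ℝ)) (hL : ∀ F ∈ L, RowBounded F.1 D F.2 ∧ 0 ≤ F.2) :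
    ∫ ω, (L.map fun F => randomCombination T F.1 ω).prod.trace ∂μ ≤
      Fintype.card ι * (η ^ L.length * (L.map fun F => D * a + L.length * F.2).prod) := by
  simp only [Matrix.trace, Matrix.diag]
  rw [integral_finsetSum _ fun _ _ => Integrable.of_finite, ← nsmul_eq_mul, ← Finset.card_univ]
  refine Finset.sum_le_card_nsmul _ _ _ fun x _ => ?_
  -- The diagonal entry at `x` is the product applied to the basis vector of `x`, with no letter
  -- seen yet.
  have := integral_prod_mulVec_le hη ha hD hT hT0 L.length L hL [] (by simp) (Pi.single x 1)
    (fun y => by by_cases h : y = x <;> simp [h])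
    (fun y => by by_cases h : y = x <;> simp [h]) x
  simpa using this

end RandomProducts

/-! ### Mixed moments of the constraints. -/

section Moments

instance : MeasurableSingletonClass (Option ℤˣ) := ⟨fun _ => trivial⟩

/-- The real value of a constraint: its sign, or `0` if it is absent. -/
def constraintValue : Option ℤˣ → ℝ
  | none => 0
  | some η => ((η : ℤ) : ℝ)

theorem constraintsTensor_eq {n k : ℕ} (Φ : XORInstance n k) (S : Fin k → Fin n) :
    constraintsTensor Φ S = constraintValue (Φ S) := rfl

theorem integral_constraintValue_pow {p : ℝ} (h0 : 0 ≤ p) (h1 : p ≤ 1) (j : ℕ) :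
    ∫ s, constraintValue s ^ j ∂constraintLaw p =
      (1 - p) * 0 ^ j + p / 2 + p / 2 * (-1) ^ j := by
  have : IsFiniteMeasure (ENNReal.ofReal (1 - p) • Measure.dirac (none : Option ℤˣ)) :=
    ⟨by simp⟩
  have : IsFiniteMeasure (ENNReal.ofReal (p / 2) • Measure.dirac (some (1 : ℤˣ))) :=
    ⟨by simp⟩
  have : IsFiniteMeasure (ENNReal.ofReal (p / 2) • Measure.dirac (some (-1 : ℤˣ))) :=
    ⟨by simp⟩
  rw [constraintLaw, integral_add_measure .of_finite .of_finite,
    integral_add_measure .of_finite .of_finite]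
  simp only [integral_smul_measure, integral_dirac, ENNReal.toReal_ofReal (sub_nonneg.2 h1),
    ENNReal.toReal_ofReal (div_nonneg h0 zero_le_two), constraintValue, smul_eq_mul]
  simp

theorem integral_constraintValue_pow_nonneg {p : ℝ} (h0 : 0 ≤ p) (h1 : p ≤ 1) (j : ℕ) :
    0 ≤ ∫ s, constraintValue s ^ j ∂constraintLaw p := by
  rw [integral_constraintValue_pow h0 h1]
  rcases Nat.even_or_odd j with hj | hj
  · rw [hj.neg_one_pow]
    have : (0 : ℝ) ≤ 0 ^ j := by positivity
    have := mul_nonneg (sub_nonneg.2 h1) this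
    nlinarith
  · rw [hj.neg_one_pow, zero_pow hj.pos.ne']; linarith

/-- Odd moments vanish and positive even ones equal `p`. A nonzero moment with `j > 0` has `j ≥ 2`,
so `p = η ^ 2 * (p / η ^ 2)` is at most the right-hand side. -/
theorem integral_constraintValue_pow_le {p η : ℝ} (h0 : 0 ≤ p) (h1 : p ≤ 1) (hη : 1 ≤ η)
    (j : ℕ) :
    ∫ s, constraintValue s ^ j ∂constraintLaw p ≤
      η ^ j * (if j = 0 then 1 else p / η ^ 2) := by
  rw [integral_constraintValue_pow h0 h1]
  rcases Nat.eq_zero_or_pos j with rfl | hpos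
  · simp; linarith
  rw [if_neg hpos.ne', zero_pow hpos.ne']
  rcases Nat.even_or_odd j with hj | hj
  · rw [hj.neg_one_pow]
    have h2 : 2 ≤ j := by rcases hj with ⟨r, rfl⟩; omega
    obtain ⟨i, rfl⟩ := Nat.exists_eq_add_of_le h2
    have hη0 : η ≠ 0 := by positivity
    have : η ^ (2 + i) * (p / η ^ 2) = η ^ i * p := by field_simp; ring
    rw [this]
    have := one_le_pow₀ hη (n := i)
    nlinarith
  · rw [hj.neg_one_pow]
    have : 0 ≤ η ^ j * (p / η ^ 2) := by positivity
    linarith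

variable {n k : ℕ}

theorem integral_prod_constraintsTensor (p : ℝ) [IsProbabilityMeasure (constraintLaw p)]
    (l : List (Fin k → Fin n)) :
    ∫ Φ, (l.map fun τ => constraintsTensor Φ τ).prod ∂randomXOR n k p =
      ∏ τ, ∫ s, constraintValue s ^ l.count τ ∂constraintLaw p := by
  rw [← integral_fintype_prod_eq_prod]
  refine integral_congr_ae (Filter.Eventually.of_forall fun Φ => ?_)
  simp only [constraintsTensor_eq]
  rw [Finset.prod_list_map_count]
  refine Finset.prod_subset (Finset.subset_univ _) fun τ _ hτ => ?_
  rw [List.count_eq_zero.2 (by simpa using hτ), pow_zero]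

theorem integral_prod_constraintsTensor_nonneg {p : ℝ} (h0 : 0 ≤ p) (h1 : p ≤ 1)
    (l : List (Fin k → Fin n)) :
    0 ≤ ∫ Φ, (l.map fun τ => constraintsTensor Φ τ).prod ∂randomXOR n k p := by
  have := isProbabilityMeasure_constraintLaw h0 h1
  rw [integral_prod_constraintsTensor]
  exact Finset.prod_nonneg fun τ _ => integral_constraintValue_pow_nonneg h0 h1 _

theorem integral_prod_constraintsTensor_le {p η : ℝ} (h0 : 0 ≤ p) (h1 : p ≤ 1) (hη : 1 ≤ η)
    (l : List (Fin k → Fin n)) :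
    ∫ Φ, (l.map fun τ => constraintsTensor Φ τ).prod ∂randomXOR n k p ≤
      η ^ l.length * (p / η ^ 2) ^ l.toFinset.card := by
  have := isProbabilityMeasure_constraintLaw h0 h1
  rw [integral_prod_constraintsTensor]
  refine (Finset.prod_le_prod (fun τ _ => integral_constraintValue_pow_nonneg h0 h1 _)
    fun τ _ => integral_constraintValue_pow_le h0 h1 hη _).trans_eq ?_
  rw [Finset.prod_mul_distrib, Finset.prod_pow_eq_pow_sum]
  congr 2
  · rw [← List.sum_toFinset_count_eq_length]
    refine (Finset.sum_subset (Finset.subset_univ _) fun τ _ hτ => ?_).symm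
    rw [List.count_eq_zero.2 (by simpa using hτ)]
  · simp only [List.count_eq_zero]
    rw [Finset.prod_ite, Finset.prod_const_one, one_mul, Finset.prod_const]
    congr 2
    ext τ; simp

end Moments

/-! ### Symmetrizers on sets of positions and their capped versions. -/

section Symmetrizers

set_option linter.unusedSectionVars false

variable {Q : Type*} [Fintype Q] [DecidableEq Q] {n : ℕ}

/-- The permutations of the positions that move only positions in `X`. -/
def permsOn (X : Finset Q) : Finset (Equiv.Perm Q) :=
  Finset.univ.filter fun h => ∀ q, q ∉ X → h q = q

theorem mem_permsOn {X : Finset Q} {h : Equiv.Perm Q} :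
    h ∈ permsOn X ↔ ∀ q, q ∉ X → h q = q := by simp [permsOn]

theorem one_mem_permsOn (X : Finset Q) : (1 : Equiv.Perm Q) ∈ permsOn X :=
  mem_permsOn.2 fun _ _ => rfl

theorem mul_mem_permsOn {X : Finset Q} {g h : Equiv.Perm Q} (hg : g ∈ permsOn X)
    (hh : h ∈ permsOn X) : g * h ∈ permsOn X := by
  rw [mem_permsOn] at *
  intro q hq
  rw [Equiv.Perm.mul_apply, hh q hq, hg q hq]

theorem inv_mem_permsOn {X : Finset Q} {h : Equiv.Perm Q} (hh : h ∈ permsOn X) :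
    h⁻¹ ∈ permsOn X := by
  rw [mem_permsOn] at *
  intro q hq
  rw [Equiv.Perm.inv_eq_iff_eq, hh q hq]

theorem permsOn_mono {X Y : Finset Q} (hXY : X ⊆ Y) : permsOn X ⊆ permsOn Y := fun _ hh =>
  mem_permsOn.2 fun q hq => mem_permsOn.1 hh q fun hqX => hq (hXY hqX)

theorem apply_mem_of_mem_permsOn {X : Finset Q} {h : Equiv.Perm Q} (hh : h ∈ permsOn X) {q : Q} :
    h q ∈ X ↔ q ∈ X := by
  constructor
  · intro hq
    by_contra hn
    rw [mem_permsOn.1 hh q hn] at hq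
    exact hn hq
  · intro hq
    by_contra hn
    have := h.injective (mem_permsOn.1 hh _ hn)
    rw [this] at hn
    exact hn hq

theorem card_permsOn (X : Finset Q) : (permsOn X).card = X.card.factorial := by
  have h1 := Fintype.card_congr (Equiv.Perm.subtypeEquivSubtypePerm fun q => q ∈ X)
  rw [Fintype.card_perm, Fintype.card_coe] at h1
  rw [h1, Fintype.card_subtype, permsOn]

theorem permsOn_univ : permsOn (Finset.univ : Finset Q) = Finset.univ := by
  ext h; simp [permsOn]

/-- The matrix of the action of a permutation of the positions on index tuples. -/
def tupleShift (n : ℕ) (h : Equiv.Perm Q) : Matrix (Q → Fin n) (Q → Fin n) ℝ :=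
  Matrix.of fun I J => if J = I ∘ h then 1 else 0

theorem tupleShift_mul_apply (h : Equiv.Perm Q) (A : Matrix (Q → Fin n) (Q → Fin n) ℝ)
    (I J : Q → Fin n) : (tupleShift n h * A) I J = A (I ∘ h) J := by
  simp [tupleShift, Matrix.mul_apply]

theorem eq_comp_perm_iff (h : Equiv.Perm Q) (I J : Q → Fin n) : J = I ∘ h ↔ I = J ∘ ⇑h⁻¹ := by
  constructor
  · rintro rfl; ext q; simp
  · rintro rfl; ext q; simp

theorem mul_tupleShift_apply (h : Equiv.Perm Q) (A : Matrix (Q → Fin n) (Q → Fin n) ℝ)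
    (I J : Q → Fin n) : (A * tupleShift n h) I J = A I (J ∘ ⇑h⁻¹) := by
  simp only [tupleShift, Matrix.mul_apply, Matrix.of_apply, eq_comp_perm_iff h _ J]
  simp

theorem tupleShift_mul (g h : Equiv.Perm Q) :
    tupleShift n g * tupleShift n h = tupleShift n (g * h) := by
  ext I J
  rw [tupleShift_mul_apply]
  rfl

theorem tupleShift_transpose (h : Equiv.Perm Q) :
    (tupleShift n h).transpose = tupleShift n h⁻¹ := by
  ext I J
  simp [tupleShift, eq_comp_perm_iff h J I]

/-- The average of the permutations moving only positions in `X`. -/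
def symmetrizer (n : ℕ) (X : Finset Q) : Matrix (Q → Fin n) (Q → Fin n) ℝ :=
  ((permsOn X).card : ℝ)⁻¹ • ∑ h ∈ permsOn X, tupleShift n h

theorem card_permsOn_pos (X : Finset Q) : (0 : ℝ) < (permsOn X).card :=
  Nat.cast_pos.2 (Finset.card_pos.2 ⟨1, one_mem_permsOn X⟩)

theorem symmetrizer_transpose (X : Finset Q) :
    (symmetrizer n X).transpose = symmetrizer n X := by
  rw [symmetrizer, Matrix.transpose_smul, Matrix.transpose_sum]
  congr 1
  refine Finset.sum_nbij' (fun h => h⁻¹) (fun h => h⁻¹) (fun _ => inv_mem_permsOn)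
    (fun _ => inv_mem_permsOn) (by simp) (by simp) fun h _ => tupleShift_transpose h

theorem symmetrizer_mul_tupleShift {X : Finset Q} {g : Equiv.Perm Q} (hg : g ∈ permsOn X) :
    symmetrizer n X * tupleShift n g = symmetrizer n X := by
  rw [symmetrizer, smul_mul_assoc, Finset.sum_mul]
  congr 1
  refine Finset.sum_nbij' (fun h => h * g) (fun h => h * g⁻¹)
    (fun h hh => mul_mem_permsOn hh hg)
    (fun h hh => mul_mem_permsOn hh (inv_mem_permsOn hg)) (by simp) (by simp)
    fun h _ => tupleShift_mul h g

theorem symmetrizer_mul_symmetrizer {X Y : Finset Q} (hXY : X ⊆ Y) :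
    symmetrizer n Y * symmetrizer n X = symmetrizer n Y := by
  conv_lhs => rw [symmetrizer.eq_1 n X]
  rw [mul_smul_comm, Finset.mul_sum,
    Finset.sum_congr rfl fun h hh => symmetrizer_mul_tupleShift (permsOn_mono hXY hh),
    Finset.sum_const, ← Nat.cast_smul_eq_nsmul ℝ, smul_smul,
    inv_mul_cancel₀ (card_permsOn_pos X).ne', one_smul]

/-- No value occurs more than `L` times among the entries of `I` at positions in `X`. -/
def Capped (L : ℝ) (X : Finset Q) (I : Q → Fin n) : Prop :=
  ∀ i, ((X.filter fun q => I q = i).card : ℝ) ≤ L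

theorem Capped.mono {L : ℝ} {X Y : Finset Q} (hXY : X ⊆ Y) {I : Q → Fin n}
    (hI : Capped L Y I) : Capped L X I := fun i =>
  (Nat.cast_le.2 (Finset.card_le_card (Finset.filter_subset_filter _ hXY))).trans (hI i)

theorem capped_congr {L : ℝ} {X : Finset Q} {I J : Q → Fin n} (h : ∀ q ∈ X, I q = J q) :
    Capped L X I ↔ Capped L X J := by
  refine forall_congr' fun i => ?_
  rw [Finset.filter_congr fun q hq => by rw [h q hq]]

theorem capped_comp {L : ℝ} {X : Finset Q} {h : Equiv.Perm Q} (hh : h ∈ permsOn X)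
    (I : Q → Fin n) : Capped L X (I ∘ h) ↔ Capped L X I := by
  refine forall_congr' fun i => ?_
  have : (X.filter fun q => (I ∘ h) q = i).card = (X.filter fun q => I q = i).card := by
    refine Finset.card_nbij' (fun q => h q) (fun q => h⁻¹ q) ?_ ?_ (by intro; simp)
      (by intro; simp)
    · intro q hq
      simp only [Finset.coe_filter, Set.mem_ofPred_eq, Function.comp_apply] at hq ⊢
      exact ⟨(apply_mem_of_mem_permsOn hh).2 hq.1, hq.2⟩
    · intro q hq
      simp only [Finset.coe_filter, Set.mem_ofPred_eq, Function.comp_apply] at hq ⊢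
      exact ⟨(apply_mem_of_mem_permsOn (inv_mem_permsOn hh)).2 hq.1, by simpa using hq.2⟩
  rw [this]

open Classical in
/-- The diagonal projection to the tuples that are capped on `X`. -/
def capMatrix (n : ℕ) (L : ℝ) (X : Finset Q) : Matrix (Q → Fin n) (Q → Fin n) ℝ :=
  Matrix.diagonal fun I => if Capped L X I then 1 else 0

theorem capMatrix_commute_tupleShift {L : ℝ} {X : Finset Q} {h : Equiv.Perm Q}
    (hh : ∀ I : Q → Fin n, Capped L X (I ∘ h) ↔ Capped L X I) :
    Commute (capMatrix n L X) (tupleShift n h) := by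
  ext I J
  rw [capMatrix, Matrix.diagonal_mul, Matrix.mul_diagonal]
  by_cases hJ : J = I ∘ h
  · have := hh I
    rw [← hJ] at this
    rw [mul_comm]
    classical
    exact congrArg (tupleShift n h I J * ·) (if_congr this.symm rfl rfl)
  · simp [tupleShift, hJ]

theorem capMatrix_mul_capMatrix {L : ℝ} {X Y : Finset Q} (hXY : X ⊆ Y) :
    capMatrix n L Y * capMatrix n L X = capMatrix n L Y := by
  rw [capMatrix, capMatrix, Matrix.diagonal_mul_diagonal]
  congr 1
  ext I
  by_cases hI : Capped L Y I
  · simp [hI, hI.mono hXY]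
  · simp [hI]

theorem commute_symmetrizer {A : Matrix (Q → Fin n) (Q → Fin n) ℝ} {X : Finset Q}
    (h : ∀ g ∈ permsOn X, Commute A (tupleShift n g)) : Commute A (symmetrizer n X) :=
  (Commute.sum_right _ _ _ h).smul_right _

/-- The symmetrizer on `X`, restricted to the tuples that are capped on `X`. -/
def cappedSymmetrizer (n : ℕ) (L : ℝ) (X : Finset Q) : Matrix (Q → Fin n) (Q → Fin n) ℝ :=
  capMatrix n L X * symmetrizer n X

theorem capMatrix_commute_symmetrizer {L : ℝ} {X Y : Finset Q} (hXY : X ⊆ Y) :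
    Commute (capMatrix n L Y) (symmetrizer n X) :=
  commute_symmetrizer fun _ hg =>
    capMatrix_commute_tupleShift fun I => capped_comp (permsOn_mono hXY hg) I

theorem cappedSymmetrizer_transpose (L : ℝ) (X : Finset Q) :
    (cappedSymmetrizer n L X).transpose = cappedSymmetrizer n L X := by
  rw [cappedSymmetrizer, Matrix.transpose_mul, symmetrizer_transpose, capMatrix,
    Matrix.diagonal_transpose, ← capMatrix]
  exact (capMatrix_commute_symmetrizer le_rfl).symm

/-- Symmetrizing over the larger set absorbs symmetrizing over the smaller, and a cap on `Y` implies
the cap on `X`. The cap on `Y` is invariant under permutations of `Y`, hence of `X`, so the two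
kinds of factors can be sorted. -/
theorem cappedSymmetrizer_mul {L : ℝ} {X Y : Finset Q} (hXY : X ⊆ Y) :
    cappedSymmetrizer n L Y * cappedSymmetrizer n L X = cappedSymmetrizer n L Y := by
  have h1 : symmetrizer n Y * capMatrix n L Y = capMatrix n L Y * symmetrizer n Y :=
    (capMatrix_commute_symmetrizer le_rfl).symm
  calc cappedSymmetrizer n L Y * cappedSymmetrizer n L X
      = capMatrix n L Y * symmetrizer n Y * (capMatrix n L X * symmetrizer n X) := rfl
    _ = symmetrizer n Y * (capMatrix n L Y * capMatrix n L X) * symmetrizer n X := by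
        rw [← h1]; noncomm_ring
    _ = symmetrizer n Y * (capMatrix n L Y * symmetrizer n X) := by
        rw [capMatrix_mul_capMatrix hXY, mul_assoc]
    _ = symmetrizer n Y * symmetrizer n X * capMatrix n L Y := by
        rw [(capMatrix_commute_symmetrizer hXY).eq, mul_assoc]
    _ = cappedSymmetrizer n L Y := by
        rw [symmetrizer_mul_symmetrizer hXY, h1, cappedSymmetrizer]

theorem mul_cappedSymmetrizer {L : ℝ} {X Y : Finset Q} (hXY : X ⊆ Y) :
    cappedSymmetrizer n L X * cappedSymmetrizer n L Y = cappedSymmetrizer n L Y := by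
  have := congrArg Matrix.transpose (cappedSymmetrizer_mul (n := n) (L := L) hXY)
  rwa [Matrix.transpose_mul, cappedSymmetrizer_transpose, cappedSymmetrizer_transpose] at this

theorem commute_cappedSymmetrizer {A : Matrix (Q → Fin n) (Q → Fin n) ℝ} {L : ℝ} {X : Finset Q}
    (h : ∀ g ∈ permsOn X, Commute A (tupleShift n g)) (hA : Commute A (capMatrix n L X)) :
    Commute A (cappedSymmetrizer n L X) :=
  hA.mul_right (commute_symmetrizer h)

theorem cappedSymmetrizer_commute {L : ℝ} {X Y : Finset Q} (hXY : Disjoint X Y) :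
    Commute (cappedSymmetrizer n L X) (cappedSymmetrizer n L Y) := by
  have hfix : ∀ {X Y : Finset Q}, Disjoint X Y → ∀ g ∈ permsOn X,
      Commute (capMatrix n L Y) (tupleShift n g) := fun hXY g hg =>
    capMatrix_commute_tupleShift fun I => capped_congr fun q hq => by
      rw [Function.comp_apply, mem_permsOn.1 hg q (Finset.disjoint_right.1 hXY hq)]
  refine commute_cappedSymmetrizer (fun g hg => ?_) ?_
  · refine (commute_cappedSymmetrizer (fun h hh => ?_) (hfix hXY.symm g hg).symm).symm
    have : Commute g h := by
      refine Equiv.Perm.Disjoint.commute fun q => ?_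
      by_cases hq : q ∈ X
      · exact Or.inl (mem_permsOn.1 hg q (Finset.disjoint_left.1 hXY hq))
      · exact Or.inr (mem_permsOn.1 hh q hq)
    rw [Commute, SemiconjBy, tupleShift_mul, tupleShift_mul, this.eq]
  · refine (commute_cappedSymmetrizer (fun h hh => hfix hXY h hh) ?_).symm
    rw [Commute, SemiconjBy, capMatrix, capMatrix, Matrix.diagonal_mul_diagonal,
      Matrix.diagonal_mul_diagonal]
    simp only [mul_comm]

open Classical in
theorem sum_cappedSymmetrizer_mul (L : ℝ) (X : Finset Q) (I : Q → Fin n)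
    (f : (Q → Fin n) → ℝ) :
    ∑ J, cappedSymmetrizer n L X I J * f J =
      (if Capped L X I then 1 else 0) *
        (((permsOn X).card : ℝ)⁻¹ * ∑ h ∈ permsOn X, f (I ∘ h)) := by
  simp only [cappedSymmetrizer, capMatrix, Matrix.diagonal_mul, symmetrizer, Matrix.smul_apply,
    Matrix.sum_apply, tupleShift, Matrix.of_apply, smul_eq_mul, mul_assoc, ← Finset.mul_sum,
    Finset.sum_mul]
  rw [Finset.sum_comm]
  simp

theorem cappedSymmetrizer_nonneg (L : ℝ) (X : Finset Q) (I J : Q → Fin n) :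
    0 ≤ cappedSymmetrizer n L X I J := by
  have := sum_cappedSymmetrizer_mul L X I (Pi.single J 1)
  simp only [Pi.single_apply, mul_ite, mul_one, mul_zero, Finset.sum_ite_eq', Finset.mem_univ,
    if_true] at this
  rw [this]
  split_ifs
  · exact mul_nonneg zero_le_one (mul_nonneg (by positivity)
      (Finset.sum_nonneg fun _ _ => by split_ifs <;> norm_num))
  · simp

theorem sum_cappedSymmetrizer_le_one (L : ℝ) (X : Finset Q) (I : Q → Fin n) :
    ∑ J, cappedSymmetrizer n L X I J ≤ 1 := by
  have := sum_cappedSymmetrizer_mul L X I fun _ => 1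
  simp only [mul_one, Finset.sum_const, nsmul_eq_mul,
    inv_mul_cancel₀ (card_permsOn_pos X).ne'] at this
  rw [this]
  split_ifs <;> norm_num

/-- A substochastic factor on the right cannot increase row sums, so only the left symmetrizer
matters in the estimates. -/
theorem sum_mul_mul_le {ι : Type*} [Fintype ι] {A B C : Matrix ι ι ℝ} (hA : ∀ x y, 0 ≤ A x y)
    (hB : ∀ x y, 0 ≤ B x y) (hC : ∀ x, ∑ y, C x y ≤ 1) (x : ι) :
    ∑ y, (A * B * C) x y ≤ ∑ y, A x y * ∑ z, B y z := by
  have h1 : ∑ y, (A * B * C) x y = ∑ z, (A * B) x z * ∑ y, C z y := by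
    simp_rw [Matrix.mul_apply (M := A * B), Finset.mul_sum]
    exact Finset.sum_comm
  have h2 : ∑ y, A x y * ∑ z, B y z = ∑ z, (A * B) x z := by
    simp_rw [Matrix.mul_apply, Finset.mul_sum]
    exact Finset.sum_comm
  rw [h1, h2]
  refine Finset.sum_le_sum fun z _ => mul_le_of_le_one_right ?_ (hC z)
  rw [Matrix.mul_apply]
  exact Finset.sum_nonneg fun y _ => mul_nonneg (hA _ _) (hB _ _)

end Symmetrizers

/-! ### Operators acting on a single block. -/

section Blocks

variable {d m n : ℕ}

/-- The positions of the `s`-th block. -/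
def block (m : ℕ) (s : Fin d) : Finset (Fin d × Fin m) := Finset.univ.filter fun q => q.1 = s

theorem mem_block {s : Fin d} {q : Fin d × Fin m} : q ∈ block m s ↔ q.1 = s := by simp [block]

theorem card_block (s : Fin d) : (block m s).card = m := by
  have : block m s = {s} ×ˢ Finset.univ := by
    ext ⟨a, b⟩
    simp [block, eq_comm]
  rw [this, Finset.card_product, Finset.card_singleton, Finset.card_univ, Fintype.card_fin,
    one_mul]

/-- The matrix acting by `g` on the `s`-th block and trivially on the other blocks. -/
def onBlock (s : Fin d) (g : Matrix (Fin m → Fin n) (Fin m → Fin n) ℝ) :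
    Matrix (Fin d × Fin m → Fin n) (Fin d × Fin m → Fin n) ℝ :=
  Matrix.of fun I J => if ∀ q, q.1 ≠ s → I q = J q then
    g (fun t => I (s, t)) (fun t => J (s, t)) else 0

theorem onBlock_transpose (s : Fin d) (g : Matrix (Fin m → Fin n) (Fin m → Fin n) ℝ) :
    (onBlock s g).transpose = onBlock s g.transpose := by
  ext I J
  simp [onBlock, eq_comm]

theorem onBlock_sum_smul {K : Type*} [Fintype K] (s : Fin d) (c : K → ℝ)
    (g : K → Matrix (Fin m → Fin n) (Fin m → Fin n) ℝ) :
    onBlock s (∑ τ, c τ • g τ) = ∑ τ, c τ • onBlock s (g τ) := by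
  ext I J
  simp only [onBlock, Matrix.of_apply, Matrix.sum_apply, Matrix.smul_apply, smul_eq_mul]
  split_ifs <;> simp

theorem onBlock_nonneg (s : Fin d) {g : Matrix (Fin m → Fin n) (Fin m → Fin n) ℝ}
    (hg : ∀ U V, 0 ≤ g U V) (I J : Fin d × Fin m → Fin n) : 0 ≤ onBlock s g I J := by
  rw [onBlock, Matrix.of_apply]
  split_ifs
  · exact hg _ _
  · exact le_rfl

theorem sum_onBlock (s : Fin d) (g : Matrix (Fin m → Fin n) (Fin m → Fin n) ℝ)
    (I : Fin d × Fin m → Fin n) :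
    ∑ J, onBlock s g I J = ∑ V, g (fun t => I (s, t)) V := by
  simp only [onBlock, Matrix.of_apply]
  rw [← Finset.sum_filter]
  refine Finset.sum_nbij' (fun J t => J (s, t)) (fun V q => if q.1 = s then V q.2 else I q)
    (by simp) ?_ ?_ ?_ (fun _ _ => rfl)
  · intro V _
    simp only [Finset.mem_filter, Finset.mem_univ, true_and]
    intro q hq
    rw [if_neg hq]
  · intro J hJ
    simp only [Finset.mem_filter, Finset.mem_univ, true_and] at hJ
    ext ⟨a, b⟩
    by_cases h : a = s
    · simp [h]
    · simp [h, hJ (a, b) h]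
  · intro V _
    simp

theorem onBlock_commute_tupleShift {s : Fin d} {X : Finset (Fin d × Fin m)}
    (hX : ∀ q ∈ X, q.1 ≠ s) (g : Matrix (Fin m → Fin n) (Fin m → Fin n) ℝ)
    {h : Equiv.Perm (Fin d × Fin m)} (hh : h ∈ permsOn X) :
    Commute (onBlock s g) (tupleShift n h) := by
  ext I J
  rw [mul_tupleShift_apply, tupleShift_mul_apply]
  have hfix : ∀ q : Fin d × Fin m, q.1 = s → h q = q := fun q hq =>
    mem_permsOn.1 hh q fun hqX => hX q hqX hq
  have hfix' : ∀ q : Fin d × Fin m, q.1 = s → h⁻¹ q = q := fun q hq =>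
    mem_permsOn.1 (inv_mem_permsOn hh) q fun hqX => hX q hqX hq
  have hiff : (∀ q : Fin d × Fin m, q.1 ≠ s → I q = (J ∘ ⇑h⁻¹) q) ↔
      (∀ q : Fin d × Fin m, q.1 ≠ s → (I ∘ h) q = J q) := by
    constructor
    · intro H q hq
      have hne : (h q).1 ≠ s := fun hs => hq (by
        have := h.injective (hfix (h q) hs)
        rwa [this] at hs)
      have := H (h q) hne
      simpa using this
    · intro H q hq
      have hne : (h⁻¹ q).1 ≠ s := fun hs => hq (by
        have := h⁻¹.injective (hfix' (h⁻¹ q) hs)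
        rwa [this] at hs)
      have := H (h⁻¹ q) hne
      simpa using this
  have h1 : (fun t => (I ∘ h) (s, t)) = fun t => I (s, t) := by
    ext t; rw [Function.comp_apply, hfix _ rfl]
  have h2 : (fun t => (J ∘ ⇑h⁻¹) (s, t)) = fun t => J (s, t) := by
    ext t; rw [Function.comp_apply, hfix' _ rfl]
  simp only [onBlock, Matrix.of_apply, h1, h2, hiff]

theorem onBlock_commute_capMatrix {s : Fin d} {X : Finset (Fin d × Fin m)}
    (hX : ∀ q ∈ X, q.1 ≠ s) (g : Matrix (Fin m → Fin n) (Fin m → Fin n) ℝ) (L : ℝ) :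
    Commute (onBlock s g) (capMatrix n L X) := by
  ext I J
  rw [capMatrix, Matrix.diagonal_mul, Matrix.mul_diagonal]
  by_cases hIJ : ∀ q : Fin d × Fin m, q.1 ≠ s → I q = J q
  · rw [mul_comm]
    classical
    exact congrArg (· * onBlock s g I J)
      (if_congr (capped_congr fun q hq => hIJ q (hX q hq)).symm rfl rfl)
  · have : onBlock s g I J = 0 := by rw [onBlock, Matrix.of_apply, if_neg hIJ]
    rw [this, mul_zero, zero_mul]

theorem onBlock_commute_cappedSymmetrizer {s : Fin d} {X : Finset (Fin d × Fin m)}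
    (hX : ∀ q ∈ X, q.1 ≠ s) (g : Matrix (Fin m → Fin n) (Fin m → Fin n) ℝ) (L : ℝ) :
    Commute (onBlock s g) (cappedSymmetrizer n L X) :=
  commute_cappedSymmetrizer (fun _ hh => onBlock_commute_tupleShift hX g hh)
    (onBlock_commute_capMatrix hX g L)

/-- Two permutations of `X` that agree on the block differ by a permutation of the remaining
positions of `X`. -/
theorem card_permsOn_fiber_le {s : Fin d} {X : Finset (Fin d × Fin m)} (hs : block m s ⊆ X)
    (e : Fin m → Fin d × Fin m) :
    ((permsOn X).filter fun h => (fun j => h (s, j)) = e).card ≤ (X.card - m).factorial := by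
  rcases Finset.eq_empty_or_nonempty ((permsOn X).filter fun h => (fun j => h (s, j)) = e)
    with h0 | ⟨h0, hh0⟩
  · simp [h0]
  have hcard : (X \ block m s).card = X.card - m := by
    rw [Finset.card_sdiff_of_subset hs, card_block]
  rw [← hcard, ← card_permsOn]
  rw [Finset.mem_filter] at hh0
  refine Finset.card_le_card_of_injOn (fun h => h0⁻¹ * h) ?_ fun _ _ _ _ h => mul_left_cancel h
  intro h hh
  rw [Finset.mem_coe, Finset.mem_filter] at hh
  rw [Finset.mem_coe, mem_permsOn]
  intro q hq
  by_cases hqX : q ∈ X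
  · have hqs : q.1 = s := by
      by_contra hne
      exact hq (Finset.mem_sdiff.2 ⟨hqX, fun hb => hne (mem_block.1 hb)⟩)
    obtain ⟨a, j⟩ := q
    obtain rfl : a = s := hqs
    rw [Equiv.Perm.mul_apply, Equiv.Perm.inv_eq_iff_eq]
    exact (congrFun hh.2 j).trans (congrFun hh0.2 j).symm
  · exact mem_permsOn.1 (mul_mem_permsOn (inv_mem_permsOn hh0.1) hh.1) q hqX

/-- A random permutation of `X` moves a prescribed word into a block with small probability. -/
theorem card_permsOn_block_eq_mul_le {L : ℝ} {s : Fin d} {X : Finset (Fin d × Fin m)}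
    (hs : block m s ⊆ X) {I : Fin d × Fin m → Fin n} (hI : Capped L X I) (U : Fin m → Fin n) :
    (((permsOn X).filter fun h => (fun j => I (h (s, j))) = U).card : ℝ) *
      (X.card.descFactorial m : ℝ) ≤ L ^ m * (permsOn X).card := by
  set P := (permsOn X).filter fun h => (fun j => I (h (s, j))) = U with hP
  -- The possible preimages of the word: slot `j` must be filled from a position of `X` carrying the
  -- value `U j`, and the cap leaves at most `L` choices.
  set E : Finset (Fin m → Fin d × Fin m) :=
    Fintype.piFinset fun j => X.filter fun q => I q = U j with hE
  have hmaps : ∀ h ∈ P, (fun j => h (s, j)) ∈ E := by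
    intro h hh
    rw [hP, Finset.mem_filter] at hh
    rw [hE, Fintype.mem_piFinset]
    intro j
    exact Finset.mem_filter.2 ⟨(apply_mem_of_mem_permsOn hh.1).2 (hs (mem_block.2 rfl)),
      congrFun hh.2 j⟩
  have hcard : P.card ≤ (X.card - m).factorial * E.card := by
    refine Finset.card_le_mul_card_image_of_maps_to hmaps _ fun e _ => ?_
    refine (Finset.card_le_card ?_).trans (card_permsOn_fiber_le hs e)
    exact Finset.filter_subset_filter _ (Finset.filter_subset _ _)
  have hEc : (E.card : ℝ) ≤ L ^ m := by
    rw [hE, Fintype.card_piFinset, Nat.cast_prod]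
    calc ∏ j : Fin m, ((X.filter fun q => I q = U j).card : ℝ) ≤ ∏ _j : Fin m, L :=
          Finset.prod_le_prod (fun _ _ => Nat.cast_nonneg _) fun j _ => hI (U j)
      _ = L ^ m := by simp
  have hm : m ≤ X.card := (card_block (m := m) s).symm.le.trans (Finset.card_le_card hs)
  rw [card_permsOn, ← Nat.factorial_mul_descFactorial hm, Nat.cast_mul]
  have h1 : (P.card : ℝ) ≤ (X.card - m).factorial * E.card := by exact_mod_cast hcard
  calc (P.card : ℝ) * (X.card.descFactorial m : ℝ)
      ≤ ((X.card - m).factorial * L ^ m) * (X.card.descFactorial m : ℝ) := by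
        gcongr
        exact h1.trans (by gcongr)
    _ = _ := by ring

end Blocks

/-! ### Inserting absorbing elements into a product. -/

section Telescoping

variable {M : Type*} [Monoid M]

theorem prod_range_reverse_succ (f : ℕ → M) (t : ℕ) :
    ((List.range (t + 1)).reverse.map f).prod = f t * ((List.range t).reverse.map f).prod := by
  rw [List.range_succ, List.reverse_append, List.map_append, List.prod_append]
  simp

/-- If absorbing elements `B t` and `A t` commute past the factors they do not interact with, they
may be inserted between the factors of a product. -/
theorem prod_insert_absorbing {A B S : ℕ → M} {d : ℕ} (hB0 : B 0 = 1)
    (hB : ∀ t < d, B (t + 1) * B t = B (t + 1)) (hA : ∀ t < d, A t * A 0 = A 0)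
    (hAB : ∀ t < d, Commute (A t) (B t)) (hBS : ∀ t < d, Commute (B t) (S t))
    (hAS : ∀ t < d, ∀ s < t, Commute (A t) (S s)) :
    ∀ t ≤ d, ((List.range t).reverse.map fun t => B (t + 1) * S t * A t).prod * A 0 =
      B t * ((List.range t).reverse.map S).prod * A 0 := by
  intro t
  induction t with
  | zero => simp [hB0]
  | succ t ih =>
    intro ht
    have htd : t < d := ht
    have hK : Commute (A t) ((List.range t).reverse.map S).prod := by
      refine Commute.list_prod_right _ _ fun x hx => ?_
      obtain ⟨s, hs, rfl⟩ := List.mem_map.1 hx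
      -- `A t` passes all earlier factors and reaches `A 0`, which absorbs it; `B t` moves left past
      -- `S t` into `B (t + 1)`.
      exact hAS t htd s (by simpa using hs)
    rw [prod_range_reverse_succ, prod_range_reverse_succ]
    set K := ((List.range t).reverse.map S).prod
    calc _ = B (t + 1) * S t * A t * (((List.range t).reverse.map
            fun t => B (t + 1) * S t * A t).prod * A 0) := by simp only [mul_assoc]
      _ = B (t + 1) * S t * (A t * B t) * K * A 0 := by
          rw [ih htd.le]; simp only [mul_assoc]
      _ = B (t + 1) * (S t * B t) * (A t * K) * A 0 := by
          rw [(hAB t htd).eq]; simp only [mul_assoc]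
      _ = B (t + 1) * B t * S t * K * (A t * A 0) := by
          rw [← (hBS t htd).eq, hK.eq]; simp only [mul_assoc]
      _ = _ := by rw [hB t htd, hA t htd]; simp only [mul_assoc]

/-- For `d > 0` the product already ends in the idempotent `A 0`, so the extra right factor `A 0` is
free. -/
theorem prod_insert_absorbing_eq {A B S : ℕ → M} {d : ℕ} (hd : 0 < d) (hB0 : B 0 = 1)
    (hB : ∀ t < d, B (t + 1) * B t = B (t + 1)) (hA : ∀ t < d, A t * A 0 = A 0)
    (hAB : ∀ t < d, Commute (A t) (B t)) (hBS : ∀ t < d, Commute (B t) (S t))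
    (hAS : ∀ t < d, ∀ s < t, Commute (A t) (S s)) :
    ((List.range d).reverse.map fun t => B (t + 1) * S t * A t).prod =
      B d * ((List.range d).reverse.map S).prod * A 0 := by
  rw [← prod_insert_absorbing hB0 hB hA hAB hBS hAS d le_rfl]
  have : ∀ t, ((List.range (t + 1)).reverse.map fun t => B (t + 1) * S t * A t).prod * A 0 =
      ((List.range (t + 1)).reverse.map fun t => B (t + 1) * S t * A t).prod := by
    intro t
    induction t with
    | zero => simp [mul_assoc, hA 0 hd]
    | succ t ih => rw [prod_range_reverse_succ, mul_assoc, ih]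
  obtain ⟨t, rfl⟩ := Nat.exists_eq_succ_of_ne_zero hd.ne'
  exact (this t).symm

end Telescoping

/-! ### Row sums for a single constraint. -/

section RowSums

variable {d m n : ℕ}

-- The symmetrizer averages the row sums of `g` over the words that permutations of `X` bring into
-- block `s`. Only the words `U₁` and `U₂` contribute, with weight one half each, and each is hit
-- with small probability.
open Classical in
theorem sum_capped_onBlock_le {L : ℝ} (hL : 0 ≤ L) {s : Fin d} {X Y : Finset (Fin d × Fin m)}
    (hX : block m s ⊆ X) {g : Matrix (Fin m → Fin n) (Fin m → Fin n) ℝ}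
    (hg : ∀ U V, 0 ≤ g U V) {U₁ U₂ : Fin m → Fin n}
    (hrow : ∀ U, ∑ V, g U V ≤ 1 / 2 * ((if U = U₁ then 1 else 0) + (if U = U₂ then 1 else 0)))
    (I : Fin d × Fin m → Fin n) :
    ∑ J, (cappedSymmetrizer n L X * onBlock s g * cappedSymmetrizer n L Y) I J ≤
      L ^ m / (X.card.descFactorial m : ℝ) := by
  have hm : m ≤ X.card := (card_block (m := m) s).symm.le.trans (Finset.card_le_card hX)
  have hdf : (0 : ℝ) < X.card.descFactorial m := Nat.cast_pos.2 (Nat.descFactorial_pos.2 hm)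
  refine (sum_mul_mul_le (fun _ _ => cappedSymmetrizer_nonneg _ _ _ _) (onBlock_nonneg s hg)
    (sum_cappedSymmetrizer_le_one _ _) I).trans ?_
  rw [sum_cappedSymmetrizer_mul]
  by_cases hI : Capped L X I
  swap
  · rw [if_neg hI, zero_mul]; positivity
  rw [if_pos hI, one_mul]
  have hcount : ∀ U : Fin m → Fin n,
      ((permsOn X).card : ℝ)⁻¹ * ∑ h ∈ permsOn X,
        (if (fun t => (I ∘ h) (s, t)) = U then (1 : ℝ) else 0) ≤
      L ^ m / (X.card.descFactorial m : ℝ) := by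
    intro U
    have h1 := card_permsOn_block_eq_mul_le hX hI U
    have h2 := card_permsOn_pos X
    rw [Finset.sum_ite, Finset.sum_const_zero, add_zero, Finset.sum_const, nsmul_eq_mul, mul_one,
      inv_mul_eq_div, div_le_div_iff₀ h2 hdf]
    exact h1
  calc _ ≤ ((permsOn X).card : ℝ)⁻¹ * ∑ h ∈ permsOn X,
        1 / 2 * ((if (fun t => (I ∘ h) (s, t)) = U₁ then (1 : ℝ) else 0) +
          (if (fun t => (I ∘ h) (s, t)) = U₂ then 1 else 0)) := by
        refine mul_le_mul_of_nonneg_left (Finset.sum_le_sum fun h _ => ?_) (by positivity)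
        rw [sum_onBlock]
        exact hrow _
    _ = 1 / 2 * (((permsOn X).card : ℝ)⁻¹ * ∑ h ∈ permsOn X,
          (if (fun t => (I ∘ h) (s, t)) = U₁ then (1 : ℝ) else 0) +
        ((permsOn X).card : ℝ)⁻¹ * ∑ h ∈ permsOn X,
          (if (fun t => (I ∘ h) (s, t)) = U₂ then (1 : ℝ) else 0)) := by
        rw [← Finset.mul_sum, Finset.sum_add_distrib]; ring
    _ ≤ 1 / 2 * (L ^ m / (X.card.descFactorial m : ℝ) +
          L ^ m / (X.card.descFactorial m : ℝ)) := by
        gcongr <;> exact hcount _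
    _ = _ := by ring

end RowSums

/-! ### The matrices attached to unit constraints. -/

section Families

variable {n k d : ℕ}

theorem joinHalves_injective (hk : Even k) {U V U' V' : Fin (k / 2) → Fin n}
    (h : joinHalves hk U V = joinHalves hk U' V') : U = U' ∧ V = V' := by
  have hk2 : k / 2 + k / 2 = k := by have := Nat.div_two_mul_two_of_even hk; omega
  have h' : Fin.append U V = Fin.append U' V' := by
    ext i
    have := congrFun h (Fin.cast hk2 i)
    simpa [joinHalves] using congrArg Fin.val this
  constructor
  · ext j
    simpa using congrArg Fin.val (congrFun h' (Fin.castAdd _ j))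
  · ext j
    have := congrFun h' (Fin.natAdd _ j)
    rw [Fin.append_right, Fin.append_right] at this
    exact congrArg Fin.val this

theorem joinHalves_surjective (hk : Even k) (τ : Fin k → Fin n) :
    ∃ U V, joinHalves hk U V = τ := by
  have hk2 : k / 2 + k / 2 = k := by have := Nat.div_two_mul_two_of_even hk; omega
  refine ⟨fun j => τ (Fin.cast hk2 (Fin.castAdd _ j)), fun j => τ (Fin.cast hk2 (Fin.natAdd _ j)),
    ?_⟩
  ext i
  rw [joinHalves]
  have := Fin.append_castAdd_natAdd (f := fun i => τ (Fin.cast hk2 i))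
  simpa using congrArg Fin.val (congrFun this (Fin.cast hk2.symm i))

/-- The contribution of a unit constraint on `τ` to the symmetric matrix representation. -/
def tupleMatrix (hk : Even k) (τ : Fin k → Fin n) :
    Matrix (Fin (k / 2) → Fin n) (Fin (k / 2) → Fin n) ℝ :=
  Matrix.of fun U V =>
    1 / 2 * ((if joinHalves hk U V = τ then 1 else 0) + (if joinHalves hk V U = τ then 1 else 0))

theorem symRep_eq_sum (hk : Even k) (Φ : XORInstance n k) :
    symRep hk Φ = ∑ τ, constraintsTensor Φ τ • tupleMatrix hk τ := by
  ext U V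
  simp only [symRep, flattening, tupleMatrix, Matrix.smul_apply, Matrix.add_apply,
    Matrix.transpose_apply, Matrix.of_apply, Matrix.sum_apply, smul_eq_mul, mul_add,
    Finset.sum_add_distrib, mul_ite, mul_one, mul_zero, Finset.sum_ite_eq, Finset.mem_univ, if_true]
  ring

theorem tupleMatrix_nonneg (hk : Even k) (τ : Fin k → Fin n) (U V : Fin (k / 2) → Fin n) :
    0 ≤ tupleMatrix hk τ U V := by
  rw [tupleMatrix, Matrix.of_apply]
  split_ifs <;> norm_num

theorem sum_tupleMatrix (hk : Even k) (U V : Fin (k / 2) → Fin n) :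
    ∑ τ, tupleMatrix hk τ U V = 1 := by
  simp only [tupleMatrix, Matrix.of_apply, ← Finset.mul_sum, Finset.sum_add_distrib]
  simp
  norm_num

theorem exists_sum_tupleMatrix_le (hk : Even k) (τ : Fin k → Fin n) :
    ∃ U₁ U₂ : Fin (k / 2) → Fin n, ∀ U, ∑ V, tupleMatrix hk τ U V ≤
      1 / 2 * ((if U = U₁ then 1 else 0) + (if U = U₂ then 1 else 0)) := by
  obtain ⟨U₁, U₂, rfl⟩ := joinHalves_surjective hk τ
  refine ⟨U₁, U₂, fun U => ?_⟩
  simp only [tupleMatrix, Matrix.of_apply, ← Finset.mul_sum, Finset.sum_add_distrib]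
  have h1 : ∀ V, (if joinHalves hk U V = joinHalves hk U₁ U₂ then (1 : ℝ) else 0) ≤
      if V = U₂ then (if U = U₁ then 1 else 0) else 0 := by
    intro V
    split_ifs with h h2 h3 h3 <;> norm_num
    · exact h3 (joinHalves_injective hk h).1
    · exact h2 (joinHalves_injective hk h).2
  have h2 : ∀ V, (if joinHalves hk V U = joinHalves hk U₁ U₂ then (1 : ℝ) else 0) ≤
      if V = U₁ then (if U = U₂ then 1 else 0) else 0 := by
    intro V
    split_ifs with h h2 h3 h3 <;> norm_num
    · exact h3 (joinHalves_injective hk h).2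
    · exact h2 (joinHalves_injective hk h).1
  have h1' := Finset.sum_le_sum fun V (_ : V ∈ Finset.univ) => h1 V
  have h2' := Finset.sum_le_sum fun V (_ : V ∈ Finset.univ) => h2 V
  rw [Finset.sum_ite_eq' Finset.univ, if_pos (Finset.mem_univ _)] at h1' h2'
  gcongr

/-- The family of matrices `C_X E_τ C_Y`, where `E_τ` lets a unit constraint on `τ` act on the
block `s`, and `C_X`, `C_Y` are capped symmetrizers. -/
def blockFamily (hk : Even k) (L : ℝ) (s : Fin d) (X Y : Finset (Position k d))
    (τ : Fin k → Fin n) : Matrix (IndexTuple n k d) (IndexTuple n k d) ℝ :=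
  cappedSymmetrizer n L X * onBlock s (tupleMatrix hk τ) * cappedSymmetrizer n L Y

theorem randomCombination_blockFamily (hk : Even k) (L : ℝ) (s : Fin d)
    (X Y : Finset (Position k d)) (Φ : XORInstance n k) :
    randomCombination (fun τ Φ => constraintsTensor Φ τ) (blockFamily hk L s X Y) Φ =
      cappedSymmetrizer n L X * onBlock s (symRep hk Φ) * cappedSymmetrizer n L Y := by
  rw [symRep_eq_sum, onBlock_sum_smul, Finset.mul_sum, Finset.sum_mul, randomCombination]
  refine Finset.sum_congr rfl fun τ _ => ?_
  rw [mul_smul_comm, smul_mul_assoc, blockFamily]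

/-- For the total: the matrices `tupleMatrix hk τ` sum to the all-ones matrix, whose row sums are `n
^ (k / 2)`, and the symmetrizers are substochastic. The bound for a single `τ` comes from the
leading symmetrizer. -/
theorem blockFamily_rowBounded (hk : Even k) {L : ℝ} (hL : 0 ≤ L) {s : Fin d}
    {X Y : Finset (Position k d)} (hX : block (k / 2) s ⊆ X) {w : ℝ}
    (hw : L ^ (k / 2) / (X.card.descFactorial (k / 2) : ℝ) ≤ w) :
    RowBounded (blockFamily (n := n) hk L s X Y) ((n : ℝ) ^ (k / 2)) w where
  nonneg τ I J := by
    rw [blockFamily, Matrix.mul_apply]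
    refine Finset.sum_nonneg fun Z _ => mul_nonneg ?_ (cappedSymmetrizer_nonneg _ _ _ _)
    rw [Matrix.mul_apply]
    exact Finset.sum_nonneg fun W _ => mul_nonneg (cappedSymmetrizer_nonneg _ _ _ _)
      (onBlock_nonneg s (tupleMatrix_nonneg hk τ) _ _)
  total I := by
    calc ∑ τ, ∑ J, blockFamily hk L s X Y τ I J
        ≤ ∑ τ, ∑ Z, cappedSymmetrizer n L X I Z *
            ∑ J, onBlock s (tupleMatrix hk τ) Z J :=
          Finset.sum_le_sum fun τ _ => sum_mul_mul_le
            (fun _ _ => cappedSymmetrizer_nonneg _ _ _ _)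
            (onBlock_nonneg s (tupleMatrix_nonneg hk τ)) (sum_cappedSymmetrizer_le_one _ _) I
      _ = ∑ Z, cappedSymmetrizer n L X I Z * (n : ℝ) ^ (k / 2) := by
          rw [Finset.sum_comm]
          refine Finset.sum_congr rfl fun Z _ => ?_
          rw [← Finset.mul_sum]
          simp only [sum_onBlock]
          rw [Finset.sum_comm]
          simp [sum_tupleMatrix]
      _ ≤ _ := by
          rw [← Finset.sum_mul]
          exact mul_le_of_le_one_left (by positivity) (sum_cappedSymmetrizer_le_one _ _ _)
  single τ I := by
    obtain ⟨U₁, U₂, h⟩ := exists_sum_tupleMatrix_le hk τ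
    refine le_trans ?_ hw
    exact sum_capped_onBlock_le hL hX (tupleMatrix_nonneg hk τ) (fun U => by convert h U) I

end Families

/-! ### The trimmed matrix as a submatrix of a product over blocks. -/

section Factorization

variable {n k d : ℕ}

/-- `onBlock`, for a block given by a natural number. -/
def onNatBlock (d : ℕ) {m : ℕ} (t : ℕ) (g : Matrix (Fin m → Fin n) (Fin m → Fin n) ℝ) :
    Matrix (Fin d × Fin m → Fin n) (Fin d × Fin m → Fin n) ℝ :=
  if h : t < d then onBlock ⟨t, h⟩ g else 1

/-- The positions in the first `t` blocks. -/
def firstBlocks (d m t : ℕ) : Finset (Fin d × Fin m) := Finset.univ.filter fun q => q.1 < t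

/-- The positions in all but the first `t` blocks. -/
def lastBlocks (d m t : ℕ) : Finset (Fin d × Fin m) := Finset.univ.filter fun q => t ≤ q.1

theorem mem_firstBlocks {m t : ℕ} {q : Fin d × Fin m} : q ∈ firstBlocks d m t ↔ q.1 < t := by
  simp [firstBlocks]

theorem mem_lastBlocks {m t : ℕ} {q : Fin d × Fin m} : q ∈ lastBlocks d m t ↔ t ≤ q.1 := by
  simp [lastBlocks]

theorem card_firstBlocks {m t : ℕ} (ht : t ≤ d) : (firstBlocks d m t).card = t * m := by
  have : firstBlocks d m t = (Finset.univ.filter fun s : Fin d => s < t) ×ˢ Finset.univ := by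
    ext ⟨a, b⟩
    simp [firstBlocks]
  rw [this, Finset.card_product, Finset.card_univ, Fintype.card_fin]
  congr 1
  simp [Fin.card_filter_val_lt, ht]

theorem card_lastBlocks {m t : ℕ} (ht : t ≤ d) : (lastBlocks d m t).card = (d - t) * m := by
  have : lastBlocks d m t = (firstBlocks d m t)ᶜ := by
    ext q
    simp [mem_lastBlocks, mem_firstBlocks]
  rw [this, Finset.card_compl, card_firstBlocks ht, Nat.sub_mul]
  simp

theorem prod_onNatBlock_apply {m : ℕ} (g : Matrix (Fin m → Fin n) (Fin m → Fin n) ℝ) :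
    ∀ t ≤ d, ∀ I J : Fin d × Fin m → Fin n,
      ((List.range t).reverse.map fun t => onNatBlock d t g).prod I J =
        if ∀ q : Fin d × Fin m, t ≤ q.1 → I q = J q then
          ∏ s : Fin d, (if s < t then g (fun j => I (s, j)) (fun j => J (s, j)) else 1)
        else 0 := by
  intro t
  induction t with
  | zero =>
    intro _ I J
    simp [Matrix.one_apply, funext_iff]
  | succ t ih =>
    intro ht I J
    have htd : t < d := ht
    rw [prod_range_reverse_succ, Matrix.mul_apply]
    -- The only contributing intermediate tuple: the left factor changes nothing outside block `t`,
    -- and the others change only earlier blocks.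
    set Z₀ : Fin d × Fin m → Fin n := fun q => if (q.1 : ℕ) < t then I q else J q with hZ₀
    rw [Finset.sum_eq_single Z₀]
    · rw [ih htd.le, onNatBlock, dif_pos htd, onBlock, Matrix.of_apply, if_pos (c := ∀ q, _ → Z₀ q = _)
        (fun q hq => by simp [hZ₀, hq.not_gt])]
      have hiff : (∀ q : Fin d × Fin m, q.1 ≠ ⟨t, htd⟩ → I q = Z₀ q) ↔
          ∀ q : Fin d × Fin m, t + 1 ≤ (q.1 : ℕ) → I q = J q := by
        constructor
        · intro H q hq
          have := H q (fun h => by rw [h] at hq; simp at hq)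
          rw [this]
          exact if_neg (by omega)
        · intro H q hq
          have hne : (q.1 : ℕ) ≠ t := fun h => hq (Fin.ext h)
          by_cases hlt : (q.1 : ℕ) < t
          · simp [hZ₀, hlt]
          · simpa [hZ₀, hlt] using H q (by omega)
      by_cases H : ∀ q : Fin d × Fin m, t + 1 ≤ (q.1 : ℕ) → I q = J q
      swap
      · rw [if_neg H, if_neg (fun h => H (hiff.1 h)), zero_mul]
      rw [if_pos H, if_pos (hiff.2 H), ← Finset.mul_prod_erase _ _ (Finset.mem_univ ⟨t, htd⟩),
        ← Finset.mul_prod_erase (a := (⟨t, htd⟩ : Fin d)) _ _ (Finset.mem_univ _)]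
      simp only [lt_irrefl, if_false, one_mul, Nat.lt_succ_self, if_true]
      congr 1
      · simp [hZ₀]
      · refine Finset.prod_congr rfl fun s hs => ?_
        have hne : (s : ℕ) ≠ t := fun h => (Finset.mem_erase.1 hs).1 (Fin.ext h)
        by_cases hlt : (s : ℕ) < t
        · simp [hZ₀, hlt, hlt.trans (Nat.lt_succ_self t)]
        · rw [if_neg hlt, if_neg (by omega)]
    · intro Z _ hZ
      rw [ih htd.le, onNatBlock, dif_pos htd, onBlock, Matrix.of_apply]
      by_cases H1 : ∀ q : Fin d × Fin m, q.1 ≠ ⟨t, htd⟩ → I q = Z q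
      · by_cases H2 : ∀ q : Fin d × Fin m, t ≤ (q.1 : ℕ) → Z q = J q
        · refine absurd (funext fun q => ?_) hZ
          by_cases hlt : (q.1 : ℕ) < t
          · rw [← H1 q (fun h => by rw [h] at hlt; simp at hlt)]
            simp [hZ₀, hlt]
          · rw [H2 q (by omega)]
            simp [hZ₀, hlt]
        · rw [if_neg H2, mul_zero]
      · rw [if_neg H1, zero_mul]
    · simp

theorem kroneckerPower_eq_prod (hk : Even k) (Φ : XORInstance n k) :
    kroneckerPower hk d Φ =
      ((List.range d).reverse.map fun t => onNatBlock d t (symRep hk Φ)).prod := by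
  ext I J
  rw [prod_onNatBlock_apply _ d le_rfl, if_pos fun q hq => absurd q.1.2 (by omega)]
  simp [kroneckerPower]

theorem higherOrderSym_eq (hk : Even k) (Φ : XORInstance n k) :
    higherOrderSym hk d Φ = symmetrizer n Finset.univ * kroneckerPower hk d Φ *
      symmetrizer n Finset.univ := by
  -- Transposing the right symmetrizer turns its action on the column index into `J ∘ σ` instead of
  -- `J ∘ σ⁻¹`.
  have ht : symmetrizer n Finset.univ * kroneckerPower hk d Φ * symmetrizer n Finset.univ =
      symmetrizer n Finset.univ * kroneckerPower hk d Φ *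
        (symmetrizer n Finset.univ).transpose := by rw [symmetrizer_transpose]
  rw [ht]
  ext I J
  simp only [symmetrizer, permsOn_univ, Finset.card_univ, Matrix.transpose_smul,
    Matrix.transpose_sum, tupleShift_transpose, smul_mul_assoc, mul_smul_comm, Finset.sum_mul,
    Finset.mul_sum, Matrix.smul_apply, Matrix.sum_apply, mul_tupleShift_apply,
    tupleShift_mul_apply, smul_eq_mul, higherOrderSym, Matrix.of_apply, inv_inv]
  rw [Finset.sum_comm]
  refine Finset.sum_congr rfl fun π _ => Finset.sum_congr rfl fun σ _ => ?_
  ring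

/-- The symmetric matrix of a random instance with the symmetrizers and caps inserted. -/
def cappedProduct (hk : Even k) (d : ℕ) (L : ℝ) (Φ : XORInstance n k) :
    Matrix (IndexTuple n k d) (IndexTuple n k d) ℝ :=
  ((List.range d).reverse.map fun t =>
    cappedSymmetrizer n L (firstBlocks d (k / 2) (t + 1)) * onNatBlock d t (symRep hk Φ) *
      cappedSymmetrizer n L (lastBlocks d (k / 2) t)).prod

theorem cappedSymmetrizer_empty {L : ℝ} (hL : 0 ≤ L) :
    cappedSymmetrizer n L (∅ : Finset (Position k d)) = 1 := by
  have h1 : permsOn (∅ : Finset (Position k d)) = {1} := by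
    ext h
    simp [mem_permsOn, Equiv.ext_iff]
  have h2 : tupleShift n (1 : Equiv.Perm (Position k d)) = 1 := by
    ext I J
    simp [tupleShift, Matrix.one_apply, eq_comm]
  simp [cappedSymmetrizer, symmetrizer, h1, h2, capMatrix, Capped, hL]

/-- Factor `t` has its inserted symmetrizers on the blocks up to and including `t` and on the blocks
from `t` on. Both contain block `t`; the telescoping only moves symmetrizers past operators on
disjoint positions. -/
theorem cappedProduct_eq (hk : Even k) {L : ℝ} (hL : 0 ≤ L) (hd : 0 < d) (Φ : XORInstance n k) :
    cappedProduct hk d L Φ =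
      capMatrix n L Finset.univ * higherOrderSym hk d Φ * capMatrix n L Finset.univ := by
  have hlast : lastBlocks d (k / 2) 0 = Finset.univ := by ext; simp [mem_lastBlocks]
  have hfirst : firstBlocks d (k / 2) d = Finset.univ := by ext; simp [mem_firstBlocks]
  have hfirst0 : firstBlocks d (k / 2) 0 = ∅ := by ext; simp [mem_firstBlocks]
  have key := prod_insert_absorbing_eq (d := d)
    (A := fun t => cappedSymmetrizer n L (lastBlocks d (k / 2) t))
    (B := fun t => cappedSymmetrizer n L (firstBlocks d (k / 2) t))
    (S := fun t => onNatBlock d t (symRep hk Φ)) hd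
    (by simp only [hfirst0]; exact cappedSymmetrizer_empty hL)
    (fun t _ => cappedSymmetrizer_mul fun q hq => by
      rw [mem_firstBlocks] at *; omega)
    (fun t _ => mul_cappedSymmetrizer fun q hq => by rw [hlast]; exact Finset.mem_univ _)
    (fun t _ => cappedSymmetrizer_commute (Finset.disjoint_left.2 fun q hq => by
      rw [mem_lastBlocks] at hq; rw [mem_firstBlocks]; omega))
    (fun t ht => by
      simp only [onNatBlock, dif_pos ht]
      refine (onBlock_commute_cappedSymmetrizer (fun q hq h => ?_) _ _).symm
      rw [mem_firstBlocks, h] at hq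
      simp at hq)
    (fun t ht s hs => by
      simp only [onNatBlock, dif_pos (hs.trans ht)]
      refine (onBlock_commute_cappedSymmetrizer (fun q hq h => ?_) _ _).symm
      rw [mem_lastBlocks, h] at hq
      simp at hq
      omega)
  rw [cappedProduct, key]
  simp only [hlast, hfirst]
  rw [← kroneckerPower_eq_prod, higherOrderSym_eq]
  have h1 : capMatrix n L Finset.univ * symmetrizer n (Finset.univ : Finset (Position k d)) =
    symmetrizer n Finset.univ * capMatrix n L Finset.univ :=
    capMatrix_commute_symmetrizer le_rfl
  have h2 : ∀ c s x : Matrix (IndexTuple n k d) (IndexTuple n k d) ℝ, c * s = s * c →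
      c * s * x * (c * s) = c * (s * x * s) * c := by
    intro c s x h
    calc c * s * x * (c * s) = c * s * x * (s * c) := congrArg (c * s * x * ·) h
      _ = _ := by simp only [mul_assoc]
  exact h2 _ _ _ h1

theorem trimmed_eq_submatrix (hk : Even k) (hn : 1 ≤ n) (hd : 0 < d) (Φ : XORInstance n k) :
    trimmed hk d Φ =
      (cappedProduct hk d (10 * Real.log n) Φ).submatrix Subtype.val Subtype.val := by
  have hL : 0 ≤ 10 * Real.log n :=
    mul_nonneg (by norm_num) (Real.log_nonneg (by exact_mod_cast hn))
  have hcap : ∀ I : KeptTuple n k d, Capped (10 * Real.log n) Finset.univ I.1 := fun I i =>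
    not_lt.1 (I.2 i)
  ext I J
  rw [cappedProduct_eq hk hL hd]
  simp [trimmed, capMatrix, hcap]

end Factorization

/-! ### The trace moment. -/

section Moment

variable {n k d : ℕ}

/-- Factor by factor, `x * m - i ≥ x * (m - i)`. -/
theorem pow_mul_factorial_le_descFactorial {x m : ℕ} (hx : 1 ≤ x) :
    x ^ m * m.factorial ≤ (x * m).descFactorial m := by
  have h : x ^ m = ∏ _i ∈ Finset.range m, x := by rw [Finset.prod_const, Finset.card_range]
  rw [← Nat.descFactorial_self, Nat.descFactorial_eq_prod_range, Nat.descFactorial_eq_prod_range,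
    h, ← Finset.prod_mul_distrib]
  refine Finset.prod_le_prod' fun i _ => ?_
  rw [Nat.mul_sub]
  exact Nat.sub_le_sub_left (Nat.le_mul_of_pos_left i hx) _

/-- A bound for the row sums of the matrices that let a unit constraint act on the `t`-th of `d`
blocks. -/
def blockWeight (L : ℝ) (m d t : ℕ) : ℝ :=
  L ^ m / m.factorial * ((d : ℝ) / ((t + 1) * (d - t))) ^ m

theorem div_descFactorial_le {L : ℝ} (hL : 0 ≤ L) {m d t x : ℕ} (hx : 1 ≤ x)
    (hxd : 1 / (x : ℝ) ≤ (d : ℝ) / ((t + 1) * (d - t))) :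
    L ^ m / ((x * m).descFactorial m : ℝ) ≤ blockWeight L m d t := by
  have hx0 : (0 : ℝ) < x := by exact_mod_cast hx
  have h1 : (x : ℝ) ^ m * m.factorial ≤ (x * m).descFactorial m := by
    exact_mod_cast pow_mul_factorial_le_descFactorial hx
  have hf : (0 : ℝ) < m.factorial := by exact_mod_cast m.factorial_pos
  calc L ^ m / ((x * m).descFactorial m : ℝ) ≤ L ^ m / ((x : ℝ) ^ m * m.factorial) := by
        gcongr
    _ = L ^ m / m.factorial * (1 / (x : ℝ)) ^ m := by
        rw [div_pow, one_pow]; field_simp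
    _ ≤ _ := by rw [blockWeight]; gcongr

/-- The right-hand side dominates both `1 / (t + 1)` and `1 / (d - t)`, so one weight serves a
factor and its transpose. -/
theorem one_div_succ_le {d t : ℕ} (ht : t < d) :
    1 / ((t + 1 : ℕ) : ℝ) ≤ (d : ℝ) / ((t + 1) * (d - t)) := by
  have h1 : (0 : ℝ) < d - t := sub_pos.2 (by exact_mod_cast ht)
  have h2 : (0 : ℝ) ≤ t := Nat.cast_nonneg t
  rw [Nat.cast_succ, div_le_div_iff₀ (by positivity) (by positivity)]
  nlinarith

theorem one_div_sub_le {d t : ℕ} (ht : t < d) :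
    1 / ((d - t : ℕ) : ℝ) ≤ (d : ℝ) / ((t + 1) * (d - t)) := by
  have h1 : (0 : ℝ) < d - t := sub_pos.2 (by exact_mod_cast ht)
  have h2 : (0 : ℝ) ≤ t := Nat.cast_nonneg t
  have h3 : (t + 1 : ℝ) ≤ d := by exact_mod_cast ht
  rw [Nat.cast_sub ht.le, div_le_div_iff₀ (by positivity) (by positivity)]
  nlinarith

/-- `blockFamily`, for a block given by a natural number. -/
def natBlockFamily (hk : Even k) (L : ℝ) (t : ℕ) (X Y : Finset (Position k d))
    (τ : Fin k → Fin n) : Matrix (IndexTuple n k d) (IndexTuple n k d) ℝ :=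
  if h : t < d then blockFamily hk L ⟨t, h⟩ X Y τ else 0

theorem natBlockFamily_rowBounded (hk : Even k) {L : ℝ} (hL : 0 ≤ L) {t : ℕ} (ht : t < d)
    {X Y : Finset (Position k d)} (hX : ∀ q : Position k d, (q.1 : ℕ) = t → q ∈ X) {x : ℕ}
    (hcard : X.card = x * (k / 2)) (hx : 1 ≤ x)
    (hxd : 1 / (x : ℝ) ≤ (d : ℝ) / ((t + 1) * (d - t))) :
    RowBounded (natBlockFamily (n := n) hk L t X Y) ((n : ℝ) ^ (k / 2))
      (blockWeight L (k / 2) d t) := by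
  have : natBlockFamily (n := n) hk L t X Y = blockFamily hk L ⟨t, ht⟩ X Y := by
    funext τ
    rw [natBlockFamily, dif_pos ht]
  rw [this]
  refine blockFamily_rowBounded hk hL (fun q hq => hX q ?_) ?_
  · rw [mem_block.1 hq]
  · rw [hcard]
    exact div_descFactorial_le hL hx hxd

theorem randomCombination_natBlockFamily (hk : Even k) (L : ℝ) {t : ℕ} (ht : t < d)
    (X Y : Finset (Position k d)) (Φ : XORInstance n k) :
    randomCombination (fun τ Φ => constraintsTensor Φ τ) (natBlockFamily hk L t X Y) Φ =
      cappedSymmetrizer n L X * onNatBlock d t (symRep hk Φ) * cappedSymmetrizer n L Y := by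
  rw [onNatBlock, dif_pos ht, ← randomCombination_blockFamily]
  congr 1
  funext τ
  rw [natBlockFamily, dif_pos ht]

theorem symRep_transpose (hk : Even k) (Φ : XORInstance n k) :
    (symRep hk Φ).transpose = symRep hk Φ := by
  rw [symRep, Matrix.transpose_smul, Matrix.transpose_add, Matrix.transpose_transpose, add_comm]

theorem cappedProduct_transpose (hk : Even k) (L : ℝ) (Φ : XORInstance n k) :
    (cappedProduct hk d L Φ).transpose = ((List.range d).map fun t =>
      cappedSymmetrizer n L (lastBlocks d (k / 2) t) * onNatBlock d t (symRep hk Φ) *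
        cappedSymmetrizer n L (firstBlocks d (k / 2) (t + 1))).prod := by
  rw [cappedProduct, Matrix.transpose_list_prod, List.map_map, ← List.map_reverse,
    List.reverse_reverse]
  refine congrArg List.prod (List.map_congr_left fun t ht => ?_)
  have h1 : (onNatBlock d t (symRep hk Φ)).transpose = onNatBlock d t (symRep hk Φ) := by
    rw [onNatBlock, dif_pos (List.mem_range.1 ht), onBlock_transpose, symRep_transpose]
  rw [Function.comp_apply, Matrix.transpose_mul, Matrix.transpose_mul, cappedSymmetrizer_transpose,
    cappedSymmetrizer_transpose, h1, mul_assoc]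

theorem blockWeight_nonneg {L : ℝ} (hL : 0 ≤ L) {m d t : ℕ} (ht : t < d) :
    0 ≤ blockWeight L m d t := by
  have h1 : (0 : ℝ) < d - t := sub_pos.2 (by exact_mod_cast ht)
  rw [blockWeight]
  positivity

/-- The power is a word of `2 * q * d` random combinations in which each block `t` is used `2 * q`
times, alternately led by the first `t + 1` blocks and by the last `d - t`. -/
theorem integral_trace_cappedProduct_le (hk : Even k) {L p η : ℝ} (hL : 0 ≤ L) (h0 : 0 ≤ p)
    (h1 : p ≤ 1) (hη : 1 ≤ η) (q : ℕ) :
    ∫ Φ, ((cappedProduct hk d L Φ * (cappedProduct hk d L Φ).transpose) ^ q).trace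
        ∂randomXOR n k p ≤
      (n : ℝ) ^ (d * (k / 2)) * (η ^ d * ∏ t ∈ Finset.range d,
        ((n : ℝ) ^ (k / 2) * (p / η ^ 2) + (2 * q * d : ℕ) * blockWeight L (k / 2) d t)) ^
          (2 * q) := by
  have := isProbabilityMeasure_constraintLaw h0 h1
  have : IsProbabilityMeasure (randomXOR n k p) := by rw [randomXOR]; infer_instance
  let w := blockWeight L (k / 2) d
  let FB : ℕ → ((Fin k → Fin n) → Matrix (IndexTuple n k d) (IndexTuple n k d) ℝ) × ℝ := fun t =>
    (natBlockFamily hk L t (firstBlocks d (k / 2) (t + 1)) (lastBlocks d (k / 2) t), w t)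
  let FA : ℕ → ((Fin k → Fin n) → Matrix (IndexTuple n k d) (IndexTuple n k d) ℝ) × ℝ := fun t =>
    (natBlockFamily hk L t (lastBlocks d (k / 2) t) (firstBlocks d (k / 2) (t + 1)), w t)
  let l := (List.range d).reverse.map FB ++ (List.range d).map FA
  let W := (List.replicate q l).flatten
  have hlen : W.length = 2 * q * d := by
    simp only [W, l, List.length_flatten, List.map_replicate, List.sum_replicate,
      List.length_append, List.length_map, List.length_reverse, List.length_range, smul_eq_mul]
    ring
  have hW : ∀ F ∈ W, RowBounded F.1 ((n : ℝ) ^ (k / 2)) F.2 ∧ 0 ≤ F.2 := by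
    intro F hF
    obtain ⟨l', hl', hFl⟩ := List.mem_flatten.1 hF
    rw [List.eq_of_mem_replicate hl'] at hFl
    rcases List.mem_append.1 hFl with hF | hF
    · obtain ⟨t, ht, rfl⟩ := List.mem_map.1 hF
      have htd : t < d := by simpa using ht
      exact ⟨natBlockFamily_rowBounded hk hL htd
        (fun q hq => mem_firstBlocks.2 (by omega)) (card_firstBlocks htd) (by omega)
        (one_div_succ_le htd), blockWeight_nonneg hL htd⟩
    · obtain ⟨t, ht, rfl⟩ := List.mem_map.1 hF
      have htd : t < d := by simpa using ht
      exact ⟨natBlockFamily_rowBounded hk hL htd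
        (fun q hq => mem_lastBlocks.2 (by omega)) (card_lastBlocks htd.le) (by omega)
        (one_div_sub_le htd), blockWeight_nonneg hL htd⟩
  have hprod : ∀ Φ, (cappedProduct hk d L Φ * (cappedProduct hk d L Φ).transpose) ^ q =
      (W.map fun F => randomCombination (fun τ Φ => constraintsTensor Φ τ) F.1 Φ).prod := by
    intro Φ
    simp only [W, l, List.map_flatten, List.map_replicate, List.prod_flatten, List.prod_replicate,
      List.map_append, List.prod_append, List.map_map]
    rw [cappedProduct_transpose, cappedProduct]
    congr 3
    · refine List.map_congr_left fun t ht => ?_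
      exact (randomCombination_natBlockFamily hk L (by simpa using ht) _ _ Φ).symm
    · refine List.map_congr_left fun t ht => ?_
      exact (randomCombination_natBlockFamily hk L (by simpa using ht) _ _ Φ).symm
  simp only [hprod]
  refine (integral_trace_prod_le (zero_le_one.trans hη) (by positivity) (by positivity)
    (fun l => integral_prod_constraintsTensor_le h0 h1 hη l)
    (fun l => integral_prod_constraintsTensor_nonneg h0 h1 l) W hW).trans_eq ?_
  have hcard : (Fintype.card (IndexTuple n k d) : ℝ) = (n : ℝ) ^ (d * (k / 2)) := by simp
  rw [hcard, hlen]
  congr 1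
  rw [mul_pow, ← pow_mul]
  congr 1
  · congr 1; ring
  · simp only [W, l, List.map_flatten, List.map_replicate, List.prod_flatten, List.prod_replicate,
      List.map_append, List.prod_append, List.map_map, List.map_reverse, List.prod_reverse]
    rw [pow_mul, pow_two (Finset.prod _ _)]
    rfl

end Moment

/-! ### Numerical estimates. -/

section Numerics

theorem prod_ratio_le_exp (d : ℕ) :
    ∏ t ∈ Finset.range d, ((d : ℝ) ^ 2 / ((t + 1) * (d - t))) ≤ Real.exp (2 * d) := by
  have h1 : ∏ t ∈ Finset.range d, ((t : ℝ) + 1) = d.factorial := by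
    rw [← Finset.prod_range_add_one_eq_factorial]; push_cast; rfl
  have h2 : ∏ t ∈ Finset.range d, ((d : ℝ) - t) = d.factorial := by
    rw [← h1, ← Finset.prod_range_reflect]
    refine Finset.prod_congr rfl fun t ht => ?_
    have : t + 1 ≤ d := Finset.mem_range.1 ht
    rw [show d - 1 - t = d - (t + 1) by omega, Nat.cast_sub this]
    push_cast; ring
  rw [Finset.prod_div_distrib, Finset.prod_mul_distrib, h1, h2, Finset.prod_const,
    Finset.card_range]
  have h3 := Real.pow_div_factorial_le_exp (d : ℝ) (Nat.cast_nonneg d) d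
  calc ((d : ℝ) ^ 2) ^ d / (d.factorial * d.factorial) = ((d : ℝ) ^ d / d.factorial) ^ 2 := by
        rw [div_pow]; ring
    _ ≤ Real.exp d ^ 2 := by gcongr
    _ = _ := by rw [← Real.exp_nat_mul]; norm_num

/-- The repeated-letter term yields the constant 12, using `m ^ m / m! ≤ e ^ m`; the new-letter term
fits into 2 more because `2 * m * l ≥ 1` and the ratio is at least 1. -/
theorem factor_le {m d t : ℕ} (hm : 1 ≤ m) (ht : t < d) {l R : ℝ} (hl : 1 / 2 ≤ l)
    (hR : R ≤ 12 * m * d * l) :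
    1 / ((m : ℝ) ^ m * (d : ℝ) ^ (m - 1)) + R * blockWeight (10 * l) m d t ≤
      1 / ((m : ℝ) ^ m * (d : ℝ) ^ (m - 1)) * (14 * m * l * (Real.exp 1 * (10 * l)) ^ m) *
        ((d : ℝ) ^ 2 / ((t + 1) * (d - t))) ^ m := by
  have h1 : (0 : ℝ) < d - t := sub_pos.2 (by exact_mod_cast ht)
  have h2 : (t + 1 : ℝ) ≤ d := by exact_mod_cast ht
  have ht0 : (0 : ℝ) ≤ t := Nat.cast_nonneg t
  have hd0 : (0 : ℝ) < d := by linarith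
  have hm0 : (1 : ℝ) ≤ m := by exact_mod_cast hm
  have hf : (0 : ℝ) < m.factorial := by exact_mod_cast m.factorial_pos
  set ρ : ℝ := (d : ℝ) ^ 2 / ((t + 1) * (d - t)) with hρ
  have hρ1 : 1 ≤ ρ := by
    rw [hρ, one_le_div (by positivity)]
    nlinarith
  have hρm : 1 ≤ ρ ^ m := one_le_pow₀ hρ1
  have hexp : (m : ℝ) ^ m / m.factorial ≤ Real.exp 1 ^ m := by
    rw [← Real.exp_nat_mul, mul_one]
    exact Real.pow_div_factorial_le_exp (m : ℝ) (by positivity) m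
  have hw : blockWeight (10 * l) m d t = (10 * l) ^ m / m.factorial * (ρ ^ m / (d : ℝ) ^ m) := by
    rw [blockWeight, ← div_pow]
    congr 2
    rw [hρ]
    field_simp
  have he1 : 1 ≤ (Real.exp 1 * (10 * l)) ^ m := by
    refine one_le_pow₀ ?_
    have := Real.add_one_le_exp (1 : ℝ)
    nlinarith
  have hdm : (d : ℝ) ^ m = d ^ (m - 1) * d := by rw [← pow_succ, Nat.sub_add_cancel hm]
  have hl0 : 0 ≤ l := by linarith
  have hA : R * blockWeight (10 * l) m d t ≤ 1 / ((m : ℝ) ^ m * (d : ℝ) ^ (m - 1)) *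
      (12 * m * l * (Real.exp 1 * (10 * l)) ^ m) * ρ ^ m := by
    calc R * blockWeight (10 * l) m d t
        ≤ 12 * m * d * l * ((10 * l) ^ m / m.factorial * (ρ ^ m / (d : ℝ) ^ m)) := by
          rw [hw]; gcongr
      _ = 1 / ((m : ℝ) ^ m * (d : ℝ) ^ (m - 1)) *
          (12 * m * l * ((m : ℝ) ^ m / m.factorial * (10 * l) ^ m)) * ρ ^ m := by
          rw [hdm]; field_simp
      _ ≤ _ := by
          rw [mul_pow (Real.exp 1)]
          gcongr
  have hB : (1 : ℝ) ≤ 2 * m * l * (Real.exp 1 * (10 * l)) ^ m * ρ ^ m := by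
    have : 1 ≤ 2 * m * l := by nlinarith
    exact one_le_mul_of_one_le_of_one_le (one_le_mul_of_one_le_of_one_le this he1) hρm
  have hB' := mul_le_mul_of_nonneg_left hB
    (by positivity : 0 ≤ 1 / ((m : ℝ) ^ m * (d : ℝ) ^ (m - 1)))
  linarith

/-- The excess `m * exp (3 * m) ≤ exp 1 ^ (4 * m)` is traded for `(10 * l) ^ (4 * m)`, which raises
the exponent of `10 * l` from `m` to `5 * m`. -/
theorem numeric_bound {m : ℕ} {l : ℝ} (hl : Real.exp 1 ≤ 10 * l) :
    Real.exp 1 * (14 * m * l * (Real.exp 1 * (10 * l)) ^ m) * Real.exp (2 * m) ≤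
      14 * Real.exp 1 * Real.exp (3 * m / 2) * (10 * l) ^ (5 * m) * l := by
  have hl0 : 0 < l := by have := Real.exp_pos 1; linarith
  have h1 : (m : ℝ) * Real.exp (3 * m) ≤ Real.exp (3 * m / 2) * (10 * l) ^ (4 * m) := by
    calc (m : ℝ) * Real.exp (3 * m) ≤ Real.exp m * Real.exp (3 * m) := by
          gcongr
          have := Real.add_one_le_exp (m : ℝ)
          linarith
      _ = Real.exp 1 ^ (4 * m) := by
          rw [← Real.exp_add, ← Real.exp_nat_mul]; push_cast; congr 1; ring
      _ ≤ (10 * l) ^ (4 * m) := by gcongr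
      _ ≤ _ := le_mul_of_one_le_left (by positivity) (Real.one_le_exp (by positivity))
  calc _ = 14 * Real.exp 1 * (10 * l) ^ m * l * (m * Real.exp (3 * m)) := by
        rw [mul_pow, ← Real.exp_nat_mul, show (3 * m : ℝ) = m * 1 + 2 * m by ring, Real.exp_add]
        ring
    _ ≤ 14 * Real.exp 1 * (10 * l) ^ m * l * (Real.exp (3 * m / 2) * (10 * l) ^ (4 * m)) := by
        gcongr
    _ = _ := by rw [show 5 * m = m + 4 * m by ring, pow_add]; ring

end Numerics

/-! ### Markov's inequality and the choice of parameters. -/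

section Concentration

variable {n k d : ℕ}

open scoped Matrix.Norms.L2Operator in
theorem spectralNorm_trimmed_pow_le (hk : Even k) (hn : 1 ≤ n) (hd : 0 < d) (a : ℕ)
    (Φ : XORInstance n k) :
    spectralNorm (trimmed hk d Φ) ^ (2 * 2 ^ (a + 1)) ≤
      ((cappedProduct hk d (10 * Real.log n) Φ *
        (cappedProduct hk d (10 * Real.log n) Φ).transpose) ^ 2 ^ (a + 1)).trace := by
  have h : spectralNorm (trimmed hk d Φ) ≤ ‖cappedProduct hk d (10 * Real.log n) Φ‖ := by
    rw [trimmed_eq_submatrix hk hn hd, spectralNorm_eq_norm]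
    exact norm_submatrix_le _ Subtype.val_injective
  exact (pow_le_pow_left₀ (norm_nonneg _) h _).trans (norm_pow_le_trace _ a)

theorem one_sub_le_measureReal_spectralNorm_le (hk : Even k) (hk0 : 0 < k) (hn : 2 ≤ n)
    (hd : 0 < d) {p η G lam : ℝ} (h0 : 0 ≤ p) (h1 : p ≤ 1) (hη : 1 ≤ η) (a : ℕ)
    (ha : 3 * ((k / 2 : ℕ) : ℝ) * Real.log n ≤ 2 * 2 ^ (a + 1)) (hG0 : 0 < G)
    (hG : η ^ d * ∏ t ∈ Finset.range d, ((n : ℝ) ^ (k / 2) * (p / η ^ 2) +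
      (2 * 2 ^ (a + 1) * d : ℕ) * blockWeight (10 * Real.log n) (k / 2) d t) ≤ G)
    (hlam : Real.exp d * G ≤ lam) :
    1 - (n : ℝ) ^ (-2 : ℝ) ≤
      (randomXOR n k p).real {Φ | spectralNorm (trimmed hk d Φ) ≤ lam} := by
  have := isProbabilityMeasure_constraintLaw h0 h1
  have : IsProbabilityMeasure (randomXOR n k p) := by rw [randomXOR]; infer_instance
  have hn0 : (0 : ℝ) < n := by exact_mod_cast (by omega : 0 < n)
  have hlog : 0 ≤ Real.log n := Real.log_nonneg (by exact_mod_cast (by omega : 1 ≤ n))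
  have hm : 1 ≤ k / 2 := by rcases hk with ⟨j, rfl⟩; omega
  have hm0 : (1 : ℝ) ≤ ((k / 2 : ℕ) : ℝ) := by exact_mod_cast hm
  have hd0 : (1 : ℝ) ≤ d := by exact_mod_cast hd
  set q := 2 ^ (a + 1) with hq
  set f : XORInstance n k → ℝ := fun Φ => ((cappedProduct hk d (10 * Real.log n) Φ *
    (cappedProduct hk d (10 * Real.log n) Φ).transpose) ^ q).trace with hf
  have hf1 : ∀ Φ, spectralNorm (trimmed hk d Φ) ^ (2 * q) ≤ f Φ := fun Φ =>
    spectralNorm_trimmed_pow_le hk (by omega) hd a Φ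
  have hnorm0 : ∀ Φ : XORInstance n k, 0 ≤ spectralNorm (trimmed hk d Φ) := fun Φ => norm_nonneg _
  have hf0 : ∀ Φ, 0 ≤ f Φ := fun Φ => (pow_nonneg (hnorm0 Φ) _).trans (hf1 Φ)
  have hlam0 : 0 < lam := lt_of_lt_of_le (by positivity) hlam
  have hprod0 : 0 ≤ η ^ d * ∏ t ∈ Finset.range d, ((n : ℝ) ^ (k / 2) * (p / η ^ 2) +
      (2 * q * d : ℕ) * blockWeight (10 * Real.log n) (k / 2) d t) := by
    refine mul_nonneg (by positivity) (Finset.prod_nonneg fun t ht => ?_)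
    have := blockWeight_nonneg (L := 10 * Real.log n) (by positivity) (m := k / 2)
      (Finset.mem_range.1 ht)
    positivity
  have hint : ∫ Φ, f Φ ∂randomXOR n k p ≤ (n : ℝ) ^ (d * (k / 2)) * G ^ (2 * q) :=
    (integral_trace_cappedProduct_le hk (by positivity) h0 h1 hη q).trans (by gcongr)
  have hmarkov := mul_meas_ge_le_integral_of_nonneg (μ := randomXOR n k p)
    (Filter.Eventually.of_forall hf0) Integrable.of_finite (lam ^ (2 * q))
  -- The dimension and the failure probability together cost `(d * m + 2) * log n ≤ 3 * d * m * log
  -- n`, which `ha` bounds by `2 * q * d`.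
  have hpow : (n : ℝ) ^ (d * (k / 2)) ≤ Real.exp d ^ (2 * q) * (n : ℝ) ^ (-2 : ℝ) := by
    rw [← Real.rpow_natCast (n : ℝ), Real.rpow_def_of_pos hn0, Real.rpow_def_of_pos hn0,
      ← Real.exp_nat_mul, ← Real.exp_add]
    refine Real.exp_le_exp.2 ?_
    push_cast
    have h2 : (1 : ℝ) ≤ d * ((k / 2 : ℕ) : ℝ) := one_le_mul_of_one_le_of_one_le hd0 hm0
    have h3 := mul_le_mul_of_nonneg_right ha (by positivity : (0 : ℝ) ≤ d)
    have h4 := mul_le_mul_of_nonneg_right h2 hlog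
    have h5 : ((q : ℕ) : ℝ) = 2 ^ (a + 1) := by rw [hq]; push_cast; rfl
    rw [h5]
    nlinarith
  have hbad : (randomXOR n k p).real {Φ | lam ^ (2 * q) ≤ f Φ} ≤ (n : ℝ) ^ (-2 : ℝ) := by
    have hlq : 0 < lam ^ (2 * q) := by positivity
    rw [← mul_le_mul_iff_right₀ hlq]
    refine hmarkov.trans (hint.trans ?_)
    calc (n : ℝ) ^ (d * (k / 2)) * G ^ (2 * q)
        ≤ (Real.exp d ^ (2 * q) * (n : ℝ) ^ (-2 : ℝ)) * G ^ (2 * q) := by gcongr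
      _ = (Real.exp d * G) ^ (2 * q) * (n : ℝ) ^ (-2 : ℝ) := by rw [mul_pow]; ring
      _ ≤ _ := by gcongr
  have hcompl : (randomXOR n k p).real {Φ | spectralNorm (trimmed hk d Φ) ≤ lam}ᶜ ≤
      (n : ℝ) ^ (-2 : ℝ) := by
    refine le_trans (measureReal_mono fun Φ hΦ => ?_) hbad
    have hlt : lam < spectralNorm (trimmed hk d Φ) := not_le.1 hΦ
    exact (pow_le_pow_left₀ hlam0.le hlt.le _).trans (hf1 Φ)
  rw [probReal_compl_eq_one_sub (Set.toFinite _).measurableSet] at hcompl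
  linarith

theorem rpow_natCast_div_two {x : ℝ} (hx : 0 ≤ x) (j : ℕ) : x ^ ((j : ℝ) / 2) = √(x ^ j) := by
  rw [Real.sqrt_eq_rpow, ← Real.rpow_natCast, ← Real.rpow_mul hx]
  congr 1
  ring

theorem exists_two_pow_between {x : ℝ} (hx : 1 ≤ x) :
    ∃ a : ℕ, x ≤ 2 * 2 ^ (a + 1) ∧ (2 * 2 ^ (a + 1) : ℝ) ≤ 4 * x := by
  obtain ⟨a, h1, h2⟩ := exists_nat_pow_near hx one_lt_two
  refine ⟨a, ?_, ?_⟩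
  · have : (0 : ℝ) ≤ 2 ^ (a + 1) := by positivity
    linarith
  · rw [pow_succ]; linarith

theorem prod_factor_le {m d : ℕ} (hm : 1 ≤ m) {l R : ℝ} (hl : 1 / 2 ≤ l) (hR0 : 0 ≤ R)
    (hR : R ≤ 12 * m * d * l) {η : ℝ} (hη : 0 ≤ η) :
    η ^ d * ∏ t ∈ Finset.range d,
        (1 / ((m : ℝ) ^ m * (d : ℝ) ^ (m - 1)) + R * blockWeight (10 * l) m d t) ≤
      (η * (1 / ((m : ℝ) ^ m * (d : ℝ) ^ (m - 1))) *
        ((14 * m * l * (Real.exp 1 * (10 * l)) ^ m) * Real.exp (2 * m))) ^ d := by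
  have hl0 : 0 ≤ l := by linarith
  set κ : ℝ := 1 / ((m : ℝ) ^ m * (d : ℝ) ^ (m - 1))
  have hκ : 0 ≤ κ := by positivity
  set Y : ℝ := 14 * m * l * (Real.exp 1 * (10 * l)) ^ m
  have hY : 0 ≤ Y := by positivity
  calc η ^ d * ∏ t ∈ Finset.range d, (κ + R * blockWeight (10 * l) m d t)
      ≤ η ^ d * ∏ t ∈ Finset.range d, (κ * Y * ((d : ℝ) ^ 2 / ((t + 1) * (d - t))) ^ m) := by
        refine mul_le_mul_of_nonneg_left (Finset.prod_le_prod (fun t ht => ?_) fun t ht =>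
          factor_le hm (Finset.mem_range.1 ht) hl hR) (by positivity)
        have := blockWeight_nonneg (L := 10 * l) (by positivity) (m := m) (Finset.mem_range.1 ht)
        positivity
    _ = (η * κ * Y) ^ d *
          (∏ t ∈ Finset.range d, ((d : ℝ) ^ 2 / ((t + 1) * (d - t)))) ^ m := by
        rw [Finset.prod_mul_distrib, Finset.prod_const, Finset.card_range, Finset.prod_pow]
        ring
    _ ≤ (η * κ * Y) ^ d * Real.exp (2 * d) ^ m := by
        refine mul_le_mul_of_nonneg_left (pow_le_pow_left₀ (Finset.prod_nonneg fun t ht => ?_)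
          (prod_ratio_le_exp d) m) (by positivity)
        have : (0 : ℝ) < d - t := sub_pos.2 (by exact_mod_cast Finset.mem_range.1 ht)
        positivity
    _ = _ := by
        rw [← mul_assoc (η * κ) Y, mul_pow (η * κ * Y), ← Real.exp_nat_mul, ← Real.exp_nat_mul]
        congr 2
        ring

/-- The bound on the `d`-th root of the norm, for `k = 2m` and `l = log n`. -/
def normBound (m d n : ℕ) (p l : ℝ) : ℝ :=
  14 * Real.exp 1 * (Real.exp (3 * m / 2) / √((m : ℝ) ^ m)) *
    (√((n : ℝ) ^ m * p) / √((d : ℝ) ^ (m - 1))) * ((10 * l) ^ (5 * m) * l)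

theorem normBound_pos {m d n : ℕ} {p l : ℝ} (hm : 1 ≤ m) (hd : 1 ≤ d)
    (hp : 1 < (d : ℝ) ^ (m - 1) * (n : ℝ) ^ m * p) (hl : 0 < l) : 0 < normBound m d n p l := by
  have hm0 : (0 : ℝ) < m := by exact_mod_cast hm
  have hd0 : (0 : ℝ) < d := by exact_mod_cast hd
  have hnp : 0 < (n : ℝ) ^ m * p := by
    by_contra h
    have := mul_nonpos_of_nonneg_of_nonpos (by positivity : 0 ≤ (d : ℝ) ^ (m - 1)) (not_lt.1 h)
    rw [mul_assoc] at hp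
    linarith
  unfold normBound
  positivity

theorem one_sub_le_measureReal_norm_le_normBound (hk : Even k) (hk0 : 0 < k) (hn : 2 ≤ n)
    (hd : 0 < d) {p : ℝ} (h0 : 0 ≤ p) (h1 : p ≤ 1)
    (hp : 1 < (d : ℝ) ^ (k / 2 - 1) * (n : ℝ) ^ (k / 2) * p) :
    1 - (n : ℝ) ^ (-2 : ℝ) ≤ (randomXOR n k p).real
      {Φ | spectralNorm (trimmed hk d Φ) ≤ normBound (k / 2) d n p (Real.log n) ^ d} := by
  have hm : 1 ≤ k / 2 := by rcases hk with ⟨j, rfl⟩; omega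
  set m := k / 2 with hmdef
  set l := Real.log n with hl
  have hl2 : Real.log 2 ≤ l := Real.log_le_log two_pos (by exact_mod_cast hn)
  have hlog2 := Real.log_two_gt_d9
  have hexp := Real.exp_one_lt_d9
  have hlh : 1 / 2 ≤ l := by linarith
  have hl0 : 0 < l := by linarith
  have hm0 : (1 : ℝ) ≤ m := by exact_mod_cast hm
  have hd0 : (0 : ℝ) < d := by exact_mod_cast hd
  have hn0 : (0 : ℝ) < n := by exact_mod_cast (by omega : 0 < n)
  have hp0 : 0 < p := by
    by_contra h
    have := mul_nonpos_of_nonneg_of_nonpos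
      (by positivity : 0 ≤ (d : ℝ) ^ (m - 1) * (n : ℝ) ^ m) (not_lt.1 h)
    linarith
  set A : ℝ := (m : ℝ) ^ m * (d : ℝ) ^ (m - 1) with hA
  have hA0 : 0 < A := by positivity
  set B : ℝ := (n : ℝ) ^ m * p with hB
  have hB0 : 0 < B := by positivity
  have hAB : 1 ≤ A * B := by
    have : 1 ≤ (m : ℝ) ^ m := one_le_pow₀ hm0
    calc (1 : ℝ) ≤ (m : ℝ) ^ m * ((d : ℝ) ^ (m - 1) * (n : ℝ) ^ m * p) :=
          one_le_mul_of_one_le_of_one_le this hp.le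
      _ = A * B := by rw [hA, hB]; ring
  -- This choice makes the new-letter term exactly `1 / A` and the overall factor `η / A` equal to
  -- `√B / √A`.
  set η : ℝ := √(A * B) with hηdef
  have hη : 1 ≤ η := Real.one_le_sqrt.2 hAB
  have hκ : (n : ℝ) ^ m * (p / η ^ 2) = 1 / A := by
    rw [hηdef, Real.sq_sqrt (by positivity), ← mul_div_assoc, ← hB]
    field_simp
  have hηA : η * (1 / A) = √B / √A := by
    rw [hηdef, Real.sqrt_mul hA0.le]
    nth_rewrite 2 [← Real.mul_self_sqrt hA0.le]
    have : √A ≠ 0 := (Real.sqrt_pos.2 hA0).ne'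
    field_simp
  -- The lower bound is what Markov's inequality needs; the upper one, four times larger, gives word
  -- length at most `12 * m * d * l`.
  obtain ⟨a, ha1, ha2⟩ := exists_two_pow_between (x := 3 * (m : ℝ) * l) (by nlinarith)
  have hR : ((2 * 2 ^ (a + 1) * d : ℕ) : ℝ) ≤ 12 * m * d * l := by
    push_cast
    have := mul_le_mul_of_nonneg_right ha2 hd0.le
    linarith
  set Y : ℝ := (14 * m * l * (Real.exp 1 * (10 * l)) ^ m) * Real.exp (2 * m) with hY
  have hY0 : 0 < Y := by positivity
  refine one_sub_le_measureReal_spectralNorm_le hk hk0 hn hd (η := η)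
    (G := (η * (1 / A) * Y) ^ d) h0 h1 hη a ha1 (by positivity) ?_ ?_
  · rw [← hmdef, ← hl, hκ]
    exact prod_factor_le hm hlh (by positivity) hR (zero_le_one.trans hη)
  · rw [show Real.exp d = Real.exp 1 ^ d by rw [← Real.exp_nat_mul, mul_one], ← mul_pow]
    refine pow_le_pow_left₀ (by positivity) ?_ d
    have hnum := numeric_bound (m := m) (l := l) (by linarith)
    calc Real.exp 1 * (η * (1 / A) * Y) = √B / √A *
          (Real.exp 1 * (14 * m * l * (Real.exp 1 * (10 * l)) ^ m) * Real.exp (2 * m)) := by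
          rw [hηA, hY]; ring
      _ ≤ √B / √A * (14 * Real.exp 1 * Real.exp (3 * m / 2) * (10 * l) ^ (5 * m) * l) := by
          gcongr
      _ = normBound m d n p l := by
          rw [normBound, ← hB, hA, Real.sqrt_mul (by positivity : 0 ≤ (m : ℝ) ^ m)]
          field_simp

end Concentration

end KXOR

end

/-! ### Conversion to real exponents. -/

theorem mainTheorem4 :
    ∃ c : ℝ, 0 < c ∧
      ∀ (k : ℕ) (hk : Even k), 0 < k →
      ∀ (d n : ℕ), 1 ≤ d → 1 ≤ n →
      ∀ p : ℝ, 0 ≤ p → p ≤ 1 →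
        1 < (d : ℝ) ^ ((k : ℝ) / 2 - 1) * (n : ℝ) ^ ((k : ℝ) / 2) * p →
        1 - (n : ℝ) ^ (-2 : ℝ) ≤
          (KXOR.randomXOR n k p).real
            {Φ : KXOR.XORInstance n k |
              KXOR.spectralNorm (KXOR.trimmed hk d Φ) ^ (1 / (d : ℝ)) ≤
                c * (Real.exp (3 * (k : ℝ) / 4) * (10 : ℝ) ^ (5 * (k : ℝ) / 2) /
                      ((k : ℝ) / 2) ^ ((k : ℝ) / 4)) *
                  ((n : ℝ) ^ ((k : ℝ) / 4) * p ^ (1 / 2 : ℝ) /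
                      (d : ℝ) ^ (((k : ℝ) - 2) / 4)) *
                  Real.log n ^ (5 * (k : ℝ) / 2 + 1)} := by
  refine ⟨14 * Real.exp 1, by positivity, fun k hk hk0 d n hd hn p h0 h1 hp => ?_⟩
  -- For `n = 1` the claimed probability bound is zero.
  rcases hn.eq_or_lt with rfl | hn2
  · simp
  have hm : 1 ≤ k / 2 := by rcases hk with ⟨j, rfl⟩; omega
  have hkm : (k : ℝ) = 2 * ((k / 2 : ℕ) : ℝ) := by
    have := Nat.two_mul_div_two_of_even hk
    exact_mod_cast this.symm
  set m := k / 2 with hmdef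
  have hl0 : 0 < Real.log n := Real.log_pos (by exact_mod_cast hn2)
  have hm1 : ((m - 1 : ℕ) : ℝ) = m - 1 := by rw [Nat.cast_sub hm, Nat.cast_one]
  have hp' : 1 < (d : ℝ) ^ (m - 1) * (n : ℝ) ^ m * p := by
    have e1 : (k : ℝ) / 2 - 1 = ((m - 1 : ℕ) : ℝ) := by rw [hm1, hkm]; ring
    have e2 : (k : ℝ) / 2 = (m : ℝ) := by rw [hkm]; ring
    rwa [e1, e2, Real.rpow_natCast, Real.rpow_natCast] at hp
  have hbound : 14 * Real.exp 1 * (Real.exp (3 * (k : ℝ) / 4) * (10 : ℝ) ^ (5 * (k : ℝ) / 2) /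
        ((k : ℝ) / 2) ^ ((k : ℝ) / 4)) *
      ((n : ℝ) ^ ((k : ℝ) / 4) * p ^ (1 / 2 : ℝ) / (d : ℝ) ^ (((k : ℝ) - 2) / 4)) *
      Real.log n ^ (5 * (k : ℝ) / 2 + 1) = KXOR.normBound m d n p (Real.log n) := by
    have e1 : 3 * (k : ℝ) / 4 = 3 * m / 2 := by rw [hkm]; ring
    have e2 : 5 * (k : ℝ) / 2 = ((5 * m : ℕ) : ℝ) := by rw [hkm]; push_cast; ring
    have e3 : (k : ℝ) / 2 = m := by rw [hkm]; ring
    have e4 : (k : ℝ) / 4 = m / 2 := by rw [hkm]; ring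
    have e5 : ((k : ℝ) - 2) / 4 = ((m - 1 : ℕ) : ℝ) / 2 := by rw [hm1, hkm]; ring
    have e6 : ((5 * m : ℕ) : ℝ) + 1 = ((5 * m + 1 : ℕ) : ℝ) := by push_cast; rfl
    rw [e1, e2, e3, e4, e5, e6, KXOR.rpow_natCast_div_two (Nat.cast_nonneg m),
      KXOR.rpow_natCast_div_two (Nat.cast_nonneg n), KXOR.rpow_natCast_div_two (Nat.cast_nonneg d),
      Real.rpow_natCast, Real.rpow_natCast, ← Real.sqrt_eq_rpow, KXOR.normBound,
      Real.sqrt_mul (by positivity), mul_pow, pow_succ]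
    ring
  rw [hbound]
  refine (KXOR.one_sub_le_measureReal_norm_le_normBound hk hk0 hn2 hd h0 h1 hp').trans ?_
  have := KXOR.isProbabilityMeasure_constraintLaw h0 h1
  have : IsProbabilityMeasure (KXOR.randomXOR n k p) := by rw [KXOR.randomXOR]; infer_instance
  refine measureReal_mono fun Φ hΦ => ?_
  have hb := KXOR.normBound_pos hm hd hp' hl0
  calc KXOR.spectralNorm (KXOR.trimmed hk d Φ) ^ (1 / (d : ℝ))
      ≤ (KXOR.normBound m d n p (Real.log n) ^ d) ^ (1 / (d : ℝ)) :=
        Real.rpow_le_rpow (norm_nonneg _) hΦ (by positivity)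
    _ = _ := by rw [one_div, Real.pow_rpow_inv_natCast hb.le (by omega)]
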